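/- Let $c,\lambda>0$, $m\in\{0,1\}$, and let $N$ be a homogeneous Poisson process of rate $\lambda$ with event times $0=s_0<s_1<s_2<\cdots$. Independently of $N$, let $\theta_1,\theta_2,\dots$ be i.i.d. with density $\frac{\Gamma(m+1)}{\sqrt\pi\,\Gamma(m+\frac12)}\sin^{2m}\theta$ on $(0,\pi)$. Consider the random motion $$X_m(s)=c\sum_{j=1}^{N(s)+1}(s_j-s_{j-1})\cos\theta_j ,\qquad s>0,$$ where in this sum $s_{N(s)+1}$ is replaced by $s$. Let $d\ge1$ be an integer, let $t>0$, and let $R=R^d(t)=\sqrt{\sum_{i=1}^d B_i^2(t)}$, where $B_1,\dots,B_d$ are independent standard Brownian motions and $R$ is independent of $(N,(\theta_j)_{j\ge1})$. Put $v_0=\frac n2$, $v_1=n+1$, and let $n\ge1$ be such that $v_m>\frac d2-1$. Then the conditional law of $X_m(R)$ given that $n$ events have occurred up to the time $R$ and given $R=s$ is, for almost every $s$ with respect to the law of $R$, the conditional law of $X_m(s)$ given $N(s)=n$. Moreover, the conditional distribution of $X_m(R^d(t))$ given the number $n$ of events, understood as the mixture of these conditional laws over the (unweighted) law of the clock $R^d(t)$,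 is absolutely continuous, and its density is a mixture, with respect to the Beta law of parameters $\frac d2$ and $v_m-\frac d2+1$, of centered Gaussian densities of variance $c^2tw$: for every Borel set $A\subseteq\mathbb R$, $$\int_0^\infty P\{X_m(R)\in A\mid N(R)=n,\,R=s\}\,P\{R\in ds\} =\int_A\frac{1}{B\left(\frac d2,v_m-\frac d2+1\right)}\int_0^1 w^{\frac d2-1}(1-w)^{v_m-\frac d2}\,\frac{e^{-\frac{x^2}{2c^2tw}}}{\sqrt{2\pi tw}\;c}\,dw\,dx ,$$ where $B(a,b)=\Gamma(a)\Gamma(b)/\Gamma(a+b)$. -/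

import Mathlib

open MeasureTheory ProbabilityTheory
open scoped NNReal ENNReal

/-- The law on `(0, π)` with density
`Γ(ν + 1) / (√π Γ(ν + 1/2)) * (sin θ) ^ (2 ν)`, from which the directions are drawn. -/
noncomputable def angleLaw (ν : ℝ) : Measure ℝ :=
  volume.withDensity fun θ =>
    ENNReal.ofReal
      (if 0 < θ ∧ θ < Real.pi then
        Real.Gamma (ν + 1) / (Real.sqrt Real.pi * Real.Gamma (ν + 1 / 2)) *
          Real.sin θ ^ (2 * ν)
      else 0)

/-- `arrivalTime τ j` is the time `s_j = τ_0 + ⋯ + τ_{j-1}` of the `j`-th event (`s_0 = 0`),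
where `τ_0, τ_1, …` are the successive waiting times. -/
noncomputable def arrivalTime {Ω : Type*} (τ : ℕ → Ω → ℝ) (j : ℕ) (ω : Ω) : ℝ :=
  ∑ i ∈ Finset.range j, τ i ω

/-- `N(s)`: the number of events that occur up to time `s`. When the waiting times are i.i.d.
exponential of parameter `lam`, this is the homogeneous Poisson process of rate `lam`. -/
noncomputable def eventCount {Ω : Type*} (τ : ℕ → Ω → ℝ) (s : ℝ) (ω : Ω) : ℕ :=
  Set.ncard {j : ℕ | 1 ≤ j ∧ arrivalTime τ j ω ≤ s}

/-- The times `s_0 = 0, s_1, …, s_{N(s)}, s_{N(s)+1} = s` which cut `[0, s]` into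
the periods of constant velocity. -/
noncomputable def switchTime {Ω : Type*} (τ : ℕ → Ω → ℝ) (s : ℝ) (j : ℕ) (ω : Ω) : ℝ :=
  if j ≤ eventCount τ s ω then arrivalTime τ j ω else s

/-- The position `X(s) = c ∑_{j=1}^{N(s)+1} (s_j - s_{j-1}) cos θ_j` at time `s`.
The directions are indexed from `0` here: `θ 0` is the initial one. -/
noncomputable def motionPosition {Ω : Type*} (c : ℝ) (τ θ : ℕ → Ω → ℝ) (s : ℝ) (ω : Ω) : ℝ :=
  c * ∑ j ∈ Finset.range (eventCount τ s ω + 1),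
    (switchTime τ s (j + 1) ω - switchTime τ s j ω) * Real.cos (θ j ω)

/-- The Bessel process `R^d(t) = √(B_1(t)² + ⋯ + B_d(t)²)`. -/
noncomputable def besselProcess {Ω : Type*} {d : ℕ} (B : Fin d → ℝ≥0 → Ω → ℝ)
    (t : ℝ≥0) (ω : Ω) : ℝ :=
  Real.sqrt (∑ i, B i t ω ^ 2)

/-- The index `v_0 = n / 2`, `v_1 = n + 1`. -/
noncomputable def motionIndex (m : Fin 2) (n : ℕ) : ℝ :=
  if m = 0 then (n : ℝ) / 2 else (n : ℝ) + 1

/-- The regular conditional law `P(X(R) ∈ · | N(R) = n, R = s)` of the position at the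
random time `R`, given the number of events up to that time and the value of `R`. -/
noncomputable def condLawAtClock {Ω : Type*} [MeasurableSpace Ω] (P : Measure Ω)
    [IsFiniteMeasure P] (c : ℝ) (τ θ : ℕ → Ω → ℝ) (R : Ω → ℝ) (n : ℕ) (s : ℝ) : Measure ℝ :=
  condDistrib (fun ω => motionPosition c τ θ (R ω) ω)
    (fun ω => (eventCount τ (R ω) ω, R ω)) P (n, s)

/-- The conditional law of the randomly timed position given `n` events, for a clock whose
own law is not affected by the number of events:
`A ↦ ∫ P(X(R) ∈ A | N(R) = n, R = s) P(R ∈ ds)`. -/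
noncomputable def condLawRandomTime {Ω : Type*} [MeasurableSpace Ω] (P : Measure Ω)
    [IsFiniteMeasure P] (c : ℝ) (τ θ : ℕ → Ω → ℝ) (R : Ω → ℝ) (n : ℕ) : Measure ℝ :=
  (P.map R).bind (condLawAtClock P c τ θ R n)

/-- The density
`x ↦ B(d/2, v-d/2+1)⁻¹ ∫₀¹ w^(d/2-1) (1-w)^(v-d/2) e^(-x²/(2c²tw)) / (√(2πtw) c) dw`.
It is `[0, ∞]`-valued, since the integral diverges for `d = 1` and `x = 0`. -/
noncomputable def betaGaussianMixtureDensity (d : ℕ) (v c t x : ℝ) : ℝ≥0∞ :=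
  (ENNReal.ofReal (beta ((d : ℝ) / 2) (v - (d : ℝ) / 2 + 1)))⁻¹ *
    ∫⁻ w in Set.Ioo (0 : ℝ) 1,
      ENNReal.ofReal
        (w ^ ((d : ℝ) / 2 - 1) * (1 - w) ^ (v - (d : ℝ) / 2) *
          (Real.exp (-(x ^ 2 / (2 * c ^ 2 * t * w))) / (Real.sqrt (2 * Real.pi * t * w) * c)))

/-! Fixed time. Put `u_j = (1 + cos θ_j) / 2`, which is Beta(m + 1/2, m + 1/2). Since the periods
add up to `s`, `(s + X(s)/c) / 2` is the sum of the `u_j` weighted by the lengths of the periods. On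
`N(s) = n` its moments are computed by peeling off the first period: the binomial theorem and a Beta
integral in time reduce `n + 1` events to `n` (`lintegral_weightedPow`). The induction closes
because of a convolution identity for Beta moments (`sum_antidiagonal_choose_mul_betaMoment`). With
`a_n = v_m + 1/2`, `W_n` of law Beta(a_n, a_n) and `G_n(z) = E (1 - z W_n)^(-(n+1))`, it says `G_0
G_n = G_{n+1}`. Moments determine a law on `[0, 1]`, so given `N(s) = n` the position is `c s (2U -
1)` in law, with `U` of law Beta(a_n, a_n) (`map_cond_motionPosition`).

Random time. The clock is independent of the motion, so conditioning on its value freezes it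
(`condDistrib_ae_eq_map_cond`). This determines the conditional law for almost every `s` because
`N(s) = n` has positive probability for each `s > 0`.

Mixture. The clock is `√(2tG)` with `G` of law Gamma(d/2). Write `G = G' w` with `G'` of law Gamma(v
+ 1) and `w` an independent Beta(d/2, v - d/2 + 1) variable; the second parameter is positive
exactly when `v > d/2 - 1`. Then `√(2G') (2U - 1)` is standard Gaussian, so `c √(2tG) (2U - 1)` is,
given `w`, a centered Gaussian of variance `c² t w`
(`lintegral_gammaMeasure_eq_betaGaussianMixture`). -/

section LebesgueIntegrals

/-! ### Substitution, Tonelli, and the Beta and Gamma integrals. -/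

theorem setLIntegral_preimage_affine {a : ℝ} (ha : 0 < a) (b : ℝ) (s : Set ℝ)
    (hs : MeasurableSet s) (f : ℝ → ℝ≥0∞) :
    ∫⁻ x in s, f x =
      ∫⁻ x in (fun x => a * x + b) ⁻¹' s, ENNReal.ofReal a * f (a * x + b) := by
  have hm : Measurable fun x : ℝ => a * x + b := by fun_prop
  have himg : (fun x : ℝ => a * x + b) '' ((fun x => a * x + b) ⁻¹' s) = s := by
    apply Set.image_preimage_eq
    intro y
    exact ⟨(y - b) / a, by field_simp; ring⟩
  conv_lhs => rw [← himg]
  rw [lintegral_image_eq_lintegral_abs_deriv_mul (f' := fun _ => a) (hm hs)]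
  · simp [abs_of_pos ha]
  · intro x _
    simpa using (((hasDerivAt_id x).const_mul a).add_const b).hasDerivWithinAt
  · intro x _ y _ h
    have : a * x + b = a * y + b := h
    simpa [ha.ne'] using this

/-- Tonelli for a planar region described by its sections; it serves the changes of variables below,
whose domains are triangles or the inside of a parabola. -/
theorem lintegral_lintegral_swap_section {S : Set (ℝ × ℝ)} (hS : MeasurableSet S)
    {h : ℝ → ℝ → ℝ≥0∞} (hh : Measurable (Function.uncurry h)) :
    ∫⁻ y, ∫⁻ x in {x | (y, x) ∈ S}, h y x = ∫⁻ x, ∫⁻ y in {y | (y, x) ∈ S}, h y x := by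
  have h1 : ∀ y, ∫⁻ x in {x | (y, x) ∈ S}, h y x
      = ∫⁻ x, S.indicator (Function.uncurry h) (y, x) := by
    intro y
    exact (lintegral_indicator (measurable_prodMk_left hS) _).symm
  have h2 : ∀ x, ∫⁻ y in {y | (y, x) ∈ S}, h y x
      = ∫⁻ y, S.indicator (Function.uncurry h) (y, x) := by
    intro x
    exact (lintegral_indicator (measurable_prodMk_right hS) _).symm
  simp_rw [h1, h2]
  exact lintegral_lintegral_swap (hh.indicator hS).aemeasurable

theorem setLIntegral_Ioi_zero_eq {φ : ℝ → ℝ≥0∞} {ψ : ℝ → ℝ≥0∞}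
    (h : ∀ x, 0 < x → φ x = ψ x) (h0 : ∀ x, x ≤ 0 → ψ x = 0) :
    ∫⁻ x in Set.Ioi 0, φ x = ∫⁻ x, ψ x := by
  rw [← lintegral_indicator measurableSet_Ioi]
  congr 1
  ext x
  by_cases hx : 0 < x
  · rw [Set.indicator_of_mem (Set.mem_Ioi.2 hx), h x hx]
  · rw [Set.indicator_of_notMem (by simpa using hx), h0 x (not_lt.1 hx)]

theorem lintegral_betaMeasure {a b : ℝ} {f : ℝ → ℝ≥0∞} (hf : Measurable f) :
    ∫⁻ x, f x ∂betaMeasure a b = ∫⁻ x in Set.Ioo 0 1,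
      ENNReal.ofReal (x ^ (a - 1) * (1 - x) ^ (b - 1) / beta a b) * f x := by
  have hm : Measurable (betaPDF a b) := by unfold betaPDF; fun_prop
  rw [betaMeasure, lintegral_withDensity_eq_lintegral_mul _ hm hf,
    ← lintegral_indicator measurableSet_Ioo]
  congr 1
  ext x
  by_cases hx : x ∈ Set.Ioo (0 : ℝ) 1
  · rw [Set.indicator_of_mem hx, Pi.mul_apply, betaPDF_of_pos_lt_one hx.1 hx.2]
    congr 2
    ring
  · rw [Set.indicator_of_notMem hx, Pi.mul_apply, betaPDF_eq,
      if_neg (show ¬(0 < x ∧ x < 1) from hx)]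
    simp

theorem lintegral_gammaMeasure {a r : ℝ} {f : ℝ → ℝ≥0∞} (hf : Measurable f) :
    ∫⁻ x, f x ∂gammaMeasure a r = ∫⁻ x in Set.Ioi 0,
      ENNReal.ofReal (r ^ a / Real.Gamma a * x ^ (a - 1) * Real.exp (-(r * x))) * f x := by
  have hm : Measurable (gammaPDF a r) := by unfold gammaPDF; fun_prop
  rw [gammaMeasure, lintegral_withDensity_eq_lintegral_mul _ hm hf,
    ← lintegral_add_compl _ measurableSet_Ici, Set.compl_Ici]
  rw [setLIntegral_congr_fun (g := 0) measurableSet_Iio]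
  · rw [setLIntegral_congr Ioi_ae_eq_Ici.symm]
    simp only [Pi.zero_apply, lintegral_zero, add_zero]
    refine setLIntegral_congr_fun measurableSet_Ioi fun x hx => ?_
    simp only [Pi.mul_apply]
    rw [gammaPDF_of_nonneg (le_of_lt hx)]
  · intro x hx
    simp [gammaPDF_of_neg hx]

/-- This restates that `betaMeasure a b` has total mass one. The Gamma integral below is obtained
from `gammaMeasure b 1` in the same way. -/
theorem setLIntegral_rpow_mul_one_sub_rpow {a b : ℝ} (ha : 0 < a) (hb : 0 < b) :
    ∫⁻ x in Set.Ioo (0 : ℝ) 1, ENNReal.ofReal (x ^ (a - 1) * (1 - x) ^ (b - 1))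
      = ENNReal.ofReal (beta a b) := by
  have hp := isProbabilityMeasureBeta ha hb
  have h1 : ∫⁻ _, 1 ∂betaMeasure a b = 1 := by simp
  rw [lintegral_betaMeasure measurable_const] at h1
  have hB := beta_pos ha hb
  calc _ = ∫⁻ x in Set.Ioo (0 : ℝ) 1, ENNReal.ofReal (beta a b) *
        (ENNReal.ofReal (x ^ (a - 1) * (1 - x) ^ (b - 1) / beta a b) * 1) := by
        refine lintegral_congr fun x => ?_
        rw [mul_one, ← ENNReal.ofReal_mul hB.le]
        congr 1
        field_simp
    _ = _ := by rw [lintegral_const_mul' _ _ ENNReal.ofReal_ne_top, h1, mul_one]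

theorem setLIntegral_rpow_mul_sub_rpow {a b g : ℝ} (ha : 0 < a) (hb : 0 < b) (hg : 0 < g) :
    ∫⁻ x in Set.Ioo (0 : ℝ) g, ENNReal.ofReal (x ^ (a - 1) * (g - x) ^ (b - 1))
      = ENNReal.ofReal (g ^ (a + b - 1) * beta a b) := by
  rw [setLIntegral_preimage_affine hg 0 _ measurableSet_Ioo,
    ENNReal.ofReal_mul (by positivity), ← setLIntegral_rpow_mul_one_sub_rpow ha hb,
    ← lintegral_const_mul' _ _ ENNReal.ofReal_ne_top]
  have hset : (fun x => g * x + 0) ⁻¹' Set.Ioo 0 g = Set.Ioo (0 : ℝ) 1 := by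
    ext x
    simp only [Set.mem_preimage, Set.mem_Ioo, add_zero]
    exact and_congr (mul_pos_iff_of_pos_left hg) (mul_lt_iff_lt_one_right hg)
  rw [hset]
  refine setLIntegral_congr_fun measurableSet_Ioo fun x hx => ?_
  have hx1 : 0 < 1 - x := by linarith [hx.2]
  rw [← ENNReal.ofReal_mul hg.le, ← ENNReal.ofReal_mul (by positivity)]
  congr 1
  rw [add_zero, show g - g * x = g * (1 - x) by ring, Real.mul_rpow hg.le hx.1.le,
    Real.mul_rpow hg.le hx1.le, show a + b - 1 = 1 + (a - 1) + (b - 1) by ring,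
    Real.rpow_add hg, Real.rpow_add hg, Real.rpow_one]
  ring

theorem setLIntegral_sub_rpow_mul_exp {b : ℝ} (hb : 0 < b) (x : ℝ) :
    ∫⁻ g in Set.Ioi x, ENNReal.ofReal ((g - x) ^ (b - 1) * Real.exp (-g))
      = ENNReal.ofReal (Real.Gamma b * Real.exp (-x)) := by
  have hp := isProbabilityMeasure_gammaMeasure hb one_pos
  have h1 : ∫⁻ _, 1 ∂gammaMeasure b 1 = 1 := by simp
  rw [lintegral_gammaMeasure measurable_const] at h1
  have hG := Real.Gamma_pos_of_pos hb
  rw [setLIntegral_preimage_affine one_pos x _ measurableSet_Ioi]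
  have hset : (fun y => 1 * y + x) ⁻¹' Set.Ioi x = Set.Ioi (0 : ℝ) := by
    ext y
    simp
  rw [hset, ← mul_one (ENNReal.ofReal (Real.Gamma b * _)), ← h1, ← lintegral_const_mul' _ _ ENNReal.ofReal_ne_top]
  refine setLIntegral_congr_fun measurableSet_Ioi fun y (hy : 0 < y) => ?_
  rw [ENNReal.ofReal_one, one_mul, mul_one, ← ENNReal.ofReal_mul (by positivity)]
  congr 1
  rw [show 1 * y + x - x = y by ring, show -(1 * y + x) = -x + -(1 * y) by ring, Real.exp_add,
    Real.one_rpow]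
  field_simp

end LebesgueIntegrals

/-! ### Beta-Gamma algebra. -/

section BetaGamma

/-- A `Gamma(a + b)` variable times an independent `Beta(a, b)` variable is `Gamma(a)`. -/
theorem lintegral_gammaMeasure_betaMeasure {a b : ℝ} (ha : 0 < a) (hb : 0 < b)
    {F : ℝ → ℝ≥0∞} (hF : Measurable F) :
    ∫⁻ g, ∫⁻ w, F (g * w) ∂betaMeasure a b ∂gammaMeasure (a + b) 1
      = ∫⁻ x, F x ∂gammaMeasure a 1 := by
  have := isProbabilityMeasureBeta ha hb
  have hGa := Real.Gamma_pos_of_pos ha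
  have hGb := Real.Gamma_pos_of_pos hb
  have hGab := Real.Gamma_pos_of_pos (add_pos ha hb)
  have hB := beta_pos ha hb
  rw [lintegral_gammaMeasure (Measurable.lintegral_prod_right' (f := fun p : ℝ × ℝ => F (p.1 * p.2))
    (by fun_prop)), lintegral_gammaMeasure hF]
  -- Joint density of `(g, x)` with `x = g w`, times `F x`. It lives on `0 < x < g`; integrating out
  -- `g` first leaves a shifted Gamma integral.
  set h : ℝ → ℝ → ℝ≥0∞ := fun g x =>
    ENNReal.ofReal (x ^ (a - 1) / (Real.Gamma a * Real.Gamma b) *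
      ((g - x) ^ (b - 1) * Real.exp (-g))) * F x with h_def
  have hh : Measurable (Function.uncurry h) := by
    simp only [h_def, Function.uncurry_def]
    fun_prop
  set S : Set (ℝ × ℝ) := {p | 0 < p.2 ∧ p.2 < p.1}
  have hS : MeasurableSet S :=
    (measurableSet_lt measurable_const measurable_snd).inter
      (measurableSet_lt measurable_snd measurable_fst)
  rw [setLIntegral_Ioi_zero_eq (ψ := fun g => ∫⁻ x in {x | (g, x) ∈ S}, h g x),
    setLIntegral_Ioi_zero_eq (ψ := fun x => ∫⁻ g in {g | (g, x) ∈ S}, h g x)]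
  · exact lintegral_lintegral_swap_section hS hh
  · intro x hx
    have hset : {g | (g, x) ∈ S} = Set.Ioi x := by
      ext g
      simp [S, hx]
    rw [hset]
    simp only [h_def]
    have hc : 0 ≤ x ^ (a - 1) / (Real.Gamma a * Real.Gamma b) := by positivity
    simp_rw [ENNReal.ofReal_mul hc, mul_right_comm _ _ (F x)]
    rw [lintegral_const_mul _ (by fun_prop), setLIntegral_sub_rpow_mul_exp hb,
      mul_right_comm _ (F x), ← ENNReal.ofReal_mul hc]
    congr 2
    rw [Real.one_rpow, one_mul]
    field_simp
  · intro x hx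
    have hset : {g | (g, x) ∈ S} = ∅ := by
      ext g
      simp [S, hx]
    simp [hset]
  · intro g hg
    have hset : {x | (g, x) ∈ S} = Set.Ioo 0 g := by
      ext x
      simp [S]
    have hpre : (fun x => g * x + 0) ⁻¹' Set.Ioo 0 g = Set.Ioo (0 : ℝ) 1 := by
      ext x
      simp only [Set.mem_preimage, Set.mem_Ioo, add_zero]
      exact and_congr (mul_pos_iff_of_pos_left hg) (mul_lt_iff_lt_one_right hg)
    rw [hset, setLIntegral_preimage_affine hg 0 _ measurableSet_Ioo, hpre,
      lintegral_betaMeasure (by fun_prop), ← lintegral_const_mul' _ _ ENNReal.ofReal_ne_top]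
    refine setLIntegral_congr_fun measurableSet_Ioo fun x hx => ?_
    have hx1 : 0 < 1 - x := by linarith [hx.2]
    have hx0 := hx.1
    simp only [h_def, add_zero]
    rw [← mul_assoc, ← mul_assoc, ← ENNReal.ofReal_mul (by positivity),
      ← ENNReal.ofReal_mul (by positivity)]
    congr 2
    rw [show g - g * x = g * (1 - x) by ring, Real.mul_rpow hg.le hx0.le,
      Real.mul_rpow hg.le hx1.le, show a + b - 1 = 1 + (a - 1) + (b - 1) by ring,
      Real.rpow_add hg, Real.rpow_add hg, Real.rpow_one, Real.one_rpow, one_mul, beta]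
    field_simp
  · intro g hg
    have hset : {x | (g, x) ∈ S} = ∅ := by
      ext x
      simp only [S, Set.mem_ofPred_eq, Set.mem_empty_iff_false, iff_false]
      intro h
      linarith [h.1, h.2]
    simp [hset]

/-- With `g = x + y`, the joint density on `0 < x < g` integrates in `x` to a Beta integral over
`(0, g)`, whose value supplies the power `g ^ (a + b - 1)`. -/
theorem gammaMeasure_conv_gammaMeasure {a b : ℝ} (ha : 0 < a) (hb : 0 < b) :
    (gammaMeasure a 1).conv (gammaMeasure b 1) = gammaMeasure (a + b) 1 := by
  have := isProbabilityMeasure_gammaMeasure ha one_pos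
  have := isProbabilityMeasure_gammaMeasure hb one_pos
  have hGa := Real.Gamma_pos_of_pos ha
  have hGb := Real.Gamma_pos_of_pos hb
  have hGab := Real.Gamma_pos_of_pos (add_pos ha hb)
  refine Measure.ext_of_lintegral _ fun f hf => ?_
  rw [Measure.lintegral_conv hf]
  rw [lintegral_gammaMeasure (Measurable.lintegral_prod_right' (f := fun p : ℝ × ℝ => f (p.1 + p.2))
    (by fun_prop)), lintegral_gammaMeasure hf]
  set h : ℝ → ℝ → ℝ≥0∞ := fun x g =>
    ENNReal.ofReal (Real.exp (-g) / (Real.Gamma a * Real.Gamma b) *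
      (x ^ (a - 1) * (g - x) ^ (b - 1))) * f g with h_def
  have hh : Measurable (Function.uncurry h) := by
    simp only [h_def, Function.uncurry_def]
    fun_prop
  set S : Set (ℝ × ℝ) := {p | 0 < p.1 ∧ p.1 < p.2}
  have hS : MeasurableSet S :=
    (measurableSet_lt measurable_const measurable_fst).inter
      (measurableSet_lt measurable_fst measurable_snd)
  rw [setLIntegral_Ioi_zero_eq (ψ := fun x => ∫⁻ g in {g | (x, g) ∈ S}, h x g),
    setLIntegral_Ioi_zero_eq (ψ := fun g => ∫⁻ x in {x | (x, g) ∈ S}, h x g)]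
  · exact lintegral_lintegral_swap_section hS hh
  · intro g hg
    have hset : {x | (x, g) ∈ S} = Set.Ioo 0 g := by
      ext x
      simp [S]
    rw [hset]
    simp only [h_def]
    have hc : 0 ≤ Real.exp (-g) / (Real.Gamma a * Real.Gamma b) := by positivity
    simp_rw [ENNReal.ofReal_mul hc, mul_right_comm _ _ (f g)]
    rw [lintegral_const_mul _ (by fun_prop), setLIntegral_rpow_mul_sub_rpow ha hb hg,
      mul_right_comm _ (f g), ← ENNReal.ofReal_mul hc]
    congr 2
    rw [Real.one_rpow, one_mul, beta]
    field_simp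
  · intro g hg
    have hset : {x | (x, g) ∈ S} = ∅ := by
      ext x
      simp only [S, Set.mem_ofPred_eq, Set.mem_empty_iff_false, iff_false]
      intro h
      linarith [h.1, h.2]
    simp [hset]
  · intro x hx
    have hset : {g | (x, g) ∈ S} = Set.Ioi x := by
      ext g
      simp [S, hx]
    have hpre : (fun y => 1 * y + x) ⁻¹' Set.Ioi x = Set.Ioi (0 : ℝ) := by
      ext y
      simp
    rw [hset, setLIntegral_preimage_affine one_pos x _ measurableSet_Ioi, hpre,
      lintegral_gammaMeasure (by fun_prop), ← lintegral_const_mul' _ _ ENNReal.ofReal_ne_top]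
    refine setLIntegral_congr_fun measurableSet_Ioi fun y (hy : 0 < y) => ?_
    simp only [h_def, ENNReal.ofReal_one, one_mul]
    rw [← mul_assoc, ← ENNReal.ofReal_mul (by positivity), add_comm y x]
    congr 2
    rw [add_sub_cancel_left, neg_add, Real.exp_add, Real.one_rpow, Real.one_rpow]
    field_simp
  · intro x hx
    have hset : {g | (x, g) ∈ S} = ∅ := by
      ext g
      simp [S, hx]
    simp [hset]

/-- If `G` is `Gamma(a + 1/2)` and `U` is an independent `Beta(a, a)` variable, then
`√(2 G) (2 U - 1)` is standard Gaussian. -/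
theorem lintegral_gammaMeasure_betaMeasure_symm {a : ℝ} (ha : 0 < a)
    {F : ℝ → ℝ≥0∞} (hF : Measurable F) :
    ∫⁻ g, ∫⁻ u, F (√(2 * g) * (2 * u - 1)) ∂betaMeasure a a ∂gammaMeasure (a + 1 / 2) 1
      = ∫⁻ x, F x ∂gaussianReal 0 1 := by
  have := isProbabilityMeasureBeta ha ha
  have := isProbabilityMeasure_gammaMeasure (show 0 < a + 1 / 2 by positivity) one_pos
  have hGa := Real.Gamma_pos_of_pos ha
  have hGh := Real.Gamma_pos_of_pos (show 0 < a + 1 / 2 by positivity)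
  have hB := beta_pos ha ha
  -- It suffices to identify the law up to a constant: both sides have mass one, so testing `F = 1`
  -- gives `C = 1`. This avoids the duplication formula for Gamma.
  obtain ⟨C, hC⟩ : ∃ C : ℝ≥0∞, ∀ F : ℝ → ℝ≥0∞, Measurable F →
      ∫⁻ g, ∫⁻ u, F (√(2 * g) * (2 * u - 1)) ∂betaMeasure a a ∂gammaMeasure (a + 1 / 2) 1
        = C * ∫⁻ x, F x ∂gaussianReal 0 1 := by
    -- With `x = √(2g) (2u - 1)` one has `u (1 - u) = (g - x²/2) / (4g)` and `du = dx / (2√(2g))`.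
    -- All loose powers of `g` cancel, and `K` is the remaining constant, with `4 ^ (-(a - 1))`
    -- split as `(1/8) ^ (a - 1) * 2 ^ (a - 1)`.
    set K : ℝ := (1 / 8) ^ (a - 1) * (1 / (2 * √2)) / (Real.Gamma (a + 1 / 2) * beta a a) *
      2 ^ (a - 1) with hK
    refine ⟨ENNReal.ofReal (K * Real.Gamma a * √(2 * Real.pi)), fun F hF => ?_⟩
    rw [lintegral_gammaMeasure
      (Measurable.lintegral_prod_right' (f := fun p : ℝ × ℝ => F (√(2 * p.1) * (2 * p.2 - 1)))
      (by fun_prop))]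
    set h : ℝ → ℝ → ℝ≥0∞ := fun g x =>
      ENNReal.ofReal (K * ((g - x ^ 2 / 2) ^ (a - 1) * Real.exp (-g))) * F x with h_def
    have hh : Measurable (Function.uncurry h) := by
      simp only [h_def, Function.uncurry_def]
      fun_prop
    set S : Set (ℝ × ℝ) := {p | p.2 ^ 2 / 2 < p.1}
    have hS : MeasurableSet S := measurableSet_lt (by fun_prop) measurable_fst
    rw [setLIntegral_Ioi_zero_eq (ψ := fun g => ∫⁻ x in {x | (g, x) ∈ S}, h g x)]
    · rw [lintegral_lintegral_swap_section hS hh, gaussianReal_of_var_ne_zero _ one_ne_zero,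
        lintegral_withDensity_eq_lintegral_mul _ (by fun_prop) hF,
        ← lintegral_const_mul _ (by fun_prop)]
      congr 1
      ext x
      have hset : {g | (g, x) ∈ S} = Set.Ioi (x ^ 2 / 2) := rfl
      rw [hset]
      simp only [h_def, Pi.mul_apply]
      have hc : 0 ≤ K := by positivity
      simp_rw [ENNReal.ofReal_mul hc, mul_right_comm _ _ (F x)]
      rw [lintegral_const_mul _ (by fun_prop), setLIntegral_sub_rpow_mul_exp ha,
        mul_right_comm _ (F x), ← ENNReal.ofReal_mul hc, gaussianPDF,
        ← mul_assoc (ENNReal.ofReal (_ * √(2 * Real.pi))),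
        ← ENNReal.ofReal_mul (by positivity)]
      congr 2
      rw [gaussianPDFReal]
      simp only [NNReal.coe_one, mul_one, sub_zero]
      rw [neg_div]
      have : √(2 * Real.pi) ≠ 0 := by positivity
      field_simp
    · intro g hg
      have h2g : 0 < √(2 * g) := by positivity
      have hsq : √(2 * g) ^ 2 = 2 * g := Real.sq_sqrt (by positivity)
      have hpre : (fun u => (2 * √(2 * g)) * u + -√(2 * g)) ⁻¹' {x | (g, x) ∈ S}
          = Set.Ioo (0 : ℝ) 1 := by
        ext u
        simp only [S, Set.mem_preimage, Set.mem_ofPred_eq, Set.mem_Ioo]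
        have : ((2 * √(2 * g)) * u + -√(2 * g)) ^ 2 = 2 * g * (2 * u - 1) ^ 2 := by
          linear_combination (2 * u - 1) ^ 2 * hsq
        rw [this]
        constructor
        · intro h
          have h1 : 0 < g * (u * (1 - u)) := by nlinarith
          have h2 : 0 < u * (1 - u) := by
            by_contra hcon
            nlinarith
          constructor <;> nlinarith
        · rintro ⟨h1, h2⟩
          have : 0 < g * (u * (1 - u)) := mul_pos hg (mul_pos h1 (by linarith))
          nlinarith
      rw [setLIntegral_preimage_affine (mul_pos two_pos h2g) (-√(2 * g)) {x | (g, x) ∈ S}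
        (measurable_prodMk_left hS), hpre,
        lintegral_betaMeasure (by fun_prop), ← lintegral_const_mul' _ _ ENNReal.ofReal_ne_top]
      refine setLIntegral_congr_fun measurableSet_Ioo fun u hu => ?_
      have hu1 : 0 < 1 - u := by linarith [hu.2]
      have hu0 := hu.1
      have harg : (2 * √(2 * g)) * u + -√(2 * g) = √(2 * g) * (2 * u - 1) := by ring
      simp only [h_def, harg]
      rw [← mul_assoc, ← mul_assoc, ← ENNReal.ofReal_mul (by positivity),
        ← ENNReal.ofReal_mul (by positivity)]
      congr 2
      rw [show g - (√(2 * g) * (2 * u - 1)) ^ 2 / 2 = 4 * g * (u * (1 - u)) by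
        rw [mul_pow, hsq]; ring]
      rw [Real.mul_rpow (by positivity) (by positivity), Real.mul_rpow (by positivity) hg.le,
        Real.mul_rpow hu0.le hu1.le, Real.one_rpow, hK,
        show a + 1 / 2 - 1 = (a - 1) + 1 / 2 by ring, Real.rpow_add hg, ← Real.sqrt_eq_rpow,
        Real.sqrt_mul (by norm_num)]
      have h4 : (1 / 8 : ℝ) ^ (a - 1) * 2 ^ (a - 1) * 4 ^ (a - 1) = 1 := by
        rw [← Real.mul_rpow (by norm_num) (by norm_num),
          ← Real.mul_rpow (by norm_num) (by norm_num)]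
        norm_num
      have hs2 : √(2 : ℝ) ≠ 0 := by positivity
      rw [one_mul]
      field_simp
      linear_combination -h4
    · intro g hg
      have hset : {x | (g, x) ∈ S} = ∅ := by
        ext x
        simp only [S, Set.mem_ofPred_eq, Set.mem_empty_iff_false, iff_false, not_lt]
        nlinarith [sq_nonneg x]
      simp [hset]
  have h1 := hC (fun _ => 1) measurable_const
  simp only [lintegral_const, measure_univ, mul_one] at h1
  rw [hC F hF, ← h1, one_mul]

end BetaGamma

/-! ### Laws of squares and cosines; moments of symmetric Beta laws. -/

section LawIdentities

theorem lintegral_eq_two_mul_setLIntegral_Ioi_of_even {f : ℝ → ℝ≥0∞} (hf : ∀ x, f (-x) = f x) :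
    ∫⁻ x, f x = 2 * ∫⁻ x in Set.Ioi 0, f x := by
  rw [← lintegral_add_compl _ measurableSet_Ioi (A := Set.Ioi (0 : ℝ)), two_mul, Set.compl_Ioi,
    setLIntegral_congr Iio_ae_eq_Iic.symm]
  congr 1
  have h := (Measure.measurePreserving_neg (volume : Measure ℝ)).setLIntegral_comp_preimage_emb
    (MeasurableEquiv.neg ℝ).measurableEmbedding f (Set.Ioi 0)
  rw [← h]
  simp [hf]

theorem map_sq_div_gaussianReal {t : ℝ≥0} (ht : 0 < t) :
    (gaussianReal 0 t).map (fun z : ℝ => z ^ 2 / (2 * (t : ℝ))) = gammaMeasure (1 / 2) 1 := by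
  have ht' : (0 : ℝ) < t := ht
  refine Measure.ext_of_lintegral _ fun f hf => ?_
  rw [lintegral_map hf (by fun_prop), gaussianReal_of_var_ne_zero _ ht.ne',
    lintegral_withDensity_eq_lintegral_mul _ (by fun_prop) (by fun_prop),
    lintegral_eq_two_mul_setLIntegral_Ioi_of_even, lintegral_gammaMeasure hf]
  swap
  · intro x
    simp [gaussianPDF, gaussianPDFReal]
  have himg : (fun z : ℝ => z ^ 2 / (2 * t)) '' Set.Ioi 0 = Set.Ioi 0 := by
    ext y
    simp only [Set.mem_image, Set.mem_Ioi]
    constructor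
    · rintro ⟨z, hz, rfl⟩
      positivity
    · intro hy
      refine ⟨√(2 * t * y), by positivity, ?_⟩
      rw [Real.sq_sqrt (by positivity)]
      field_simp
  conv_rhs => rw [← himg]
  rw [lintegral_image_eq_lintegral_abs_deriv_mul (f' := fun z => z / t) measurableSet_Ioi]
  · rw [← lintegral_const_mul' _ _ (by simp)]
    refine setLIntegral_congr_fun measurableSet_Ioi fun z (hz : 0 < z) => ?_
    simp only [Pi.mul_apply, gaussianPDF, gaussianPDFReal]
    rw [← mul_assoc, ← mul_assoc, ← ENNReal.ofReal_mul (by positivity),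
      show (2 : ℝ≥0∞) = ENNReal.ofReal 2 by simp, ← ENNReal.ofReal_mul (by positivity)]
    congr 2
    rw [abs_of_pos (by positivity), Real.one_rpow, Real.Gamma_one_half_eq,
      show (1 / 2 - 1 : ℝ) = -(1 / 2) by norm_num, Real.rpow_neg (by positivity),
      ← Real.sqrt_eq_rpow, Real.sqrt_div (by positivity), Real.sqrt_sq hz.le, sub_zero, one_mul,
      neg_div, Real.sqrt_mul (by positivity), Real.sqrt_mul (by positivity),
      Real.sqrt_mul (by positivity)]
    have h2 : √(2 : ℝ) ^ 2 = 2 := Real.sq_sqrt (by norm_num)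
    have h3 : √(t : ℝ) ^ 2 = t := Real.sq_sqrt (by positivity)
    have := Real.sqrt_pos.2 ht'
    have := Real.sqrt_pos.2 Real.pi_pos
    field_simp
    rw [h2, h3]
  · intro z _
    have h := ((hasDerivAt_pow 2 z).div_const (2 * (t : ℝ))).hasDerivWithinAt (s := Set.Ioi 0)
    have h' : ((2 : ℕ) : ℝ) * z ^ (2 - 1) / (2 * (t : ℝ)) = z / t := by
      push_cast
      field_simp
    rwa [h'] at h
  · intro x hx y hy h
    have hx' : (0 : ℝ) < x := hx
    have hy' : (0 : ℝ) < y := hy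
    have h' : x ^ 2 / (2 * (t : ℝ)) = y ^ 2 / (2 * t) := h
    have h'' : x ^ 2 = y ^ 2 := by field_simp at h'; exact h'
    exact (sq_eq_sq₀ hx'.le hy'.le).1 h''

/-- For `u = (1 + cos θ) / 2`, `u (1 - u) = (sin θ / 2)²` and `|du| = (sin θ / 2) dθ`, so the
symmetric Beta density pulls back to a multiple of `sin ^ (2ν)`. The multiple is fixed by comparing
total masses, which is why `angleLaw ν` is assumed to be a probability measure. -/
theorem map_angleLaw {ν : ℝ} (hν : 0 ≤ ν) [IsProbabilityMeasure (angleLaw ν)] :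
    (angleLaw ν).map (fun θ => (1 + Real.cos θ) / 2) = betaMeasure (ν + 1 / 2) (ν + 1 / 2) := by
  have ha : 0 < ν + 1 / 2 := by positivity
  have hB := beta_pos ha ha
  have := isProbabilityMeasureBeta ha ha
  have hG1 := Real.Gamma_pos_of_pos (show 0 < ν + 1 by positivity)
  have hG2 := Real.Gamma_pos_of_pos ha
  obtain ⟨C, hC⟩ : ∃ C : ℝ≥0∞, ∀ f : ℝ → ℝ≥0∞, Measurable f →
      ∫⁻ θ, f ((1 + Real.cos θ) / 2) ∂angleLaw ν
        = C * ∫⁻ u, f u ∂betaMeasure (ν + 1 / 2) (ν + 1 / 2) := by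
    refine ⟨ENNReal.ofReal (Real.Gamma (ν + 1) / (√Real.pi * Real.Gamma (ν + 1 / 2)) *
      beta (ν + 1 / 2) (ν + 1 / 2) * 2 ^ (2 * ν)), fun f hf => ?_⟩
    rw [angleLaw, lintegral_withDensity_eq_lintegral_mul _ _ (by fun_prop)]
    swap
    · exact (Measurable.ite measurableSet_Ioo (by fun_prop) measurable_const).ennreal_ofReal
    have himg : (fun θ : ℝ => (1 + Real.cos θ) / 2) '' Set.Ioo 0 Real.pi = Set.Ioo 0 1 := by
      ext y
      simp only [Set.mem_image, Set.mem_Ioo]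
      constructor
      · rintro ⟨z, ⟨hz0, hz1⟩, rfl⟩
        have h1 := Real.strictAntiOn_cos ⟨le_rfl, Real.pi_pos.le⟩ ⟨hz0.le, hz1.le⟩ hz0
        have h2 := Real.strictAntiOn_cos ⟨hz0.le, hz1.le⟩ ⟨Real.pi_pos.le, le_rfl⟩ hz1
        rw [Real.cos_zero] at h1
        rw [Real.cos_pi] at h2
        constructor <;> linarith
      · rintro ⟨h0, h1⟩
        refine ⟨Real.arccos (2 * y - 1), ⟨Real.arccos_pos.2 (by linarith), ?_⟩, ?_⟩
        · refine lt_of_le_of_ne (Real.arccos_le_pi _) fun h => ?_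
          rw [Real.arccos_eq_pi] at h
          linarith
        · rw [Real.cos_arccos (by linarith) (by linarith)]
          ring
    rw [lintegral_betaMeasure hf, ← himg,
      lintegral_image_eq_lintegral_abs_deriv_mul (f' := fun θ => -Real.sin θ / 2)
        measurableSet_Ioo, ← lintegral_const_mul' _ _ ENNReal.ofReal_ne_top,
      ← lintegral_indicator measurableSet_Ioo]
    · congr 1
      ext θ
      by_cases hθ : θ ∈ Set.Ioo 0 Real.pi
      · rw [Set.indicator_of_mem hθ, Pi.mul_apply, if_pos (show 0 < θ ∧ θ < Real.pi from hθ)]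
        have hs : 0 < Real.sin θ := Real.sin_pos_of_mem_Ioo hθ
        rw [← mul_assoc, ← mul_assoc, ← ENNReal.ofReal_mul (by positivity),
          ← ENNReal.ofReal_mul (by positivity)]
        congr 2
        have hc1 : 0 ≤ (1 + Real.cos θ) / 2 := by linarith [Real.neg_one_le_cos θ]
        have hc2 : 0 ≤ 1 - (1 + Real.cos θ) / 2 := by linarith [Real.cos_le_one θ]
        rw [← Real.mul_rpow hc1 hc2, show (1 + Real.cos θ) / 2 * (1 - (1 + Real.cos θ) / 2)
          = (Real.sin θ / 2) ^ 2 by linear_combination (-1 / 4) * Real.sin_sq_add_cos_sq θ,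
          ← Real.rpow_natCast, ← Real.rpow_mul (by positivity), neg_div, abs_neg,
          abs_of_pos (by positivity)]
        have h2 : Real.sin θ / 2 * (Real.sin θ / 2) ^ (((2 : ℕ) : ℝ) * (ν + 1 / 2 - 1))
            = (Real.sin θ / 2) ^ (2 * ν) := by
          rw [show 2 * ν = 1 + ((2 : ℕ) : ℝ) * (ν + 1 / 2 - 1) by push_cast; ring,
            Real.rpow_add (by positivity), Real.rpow_one]
        have h3 : (Real.sin θ / 2) ^ (2 * ν) = Real.sin θ ^ (2 * ν) / 2 ^ (2 * ν) :=
          Real.div_rpow hs.le (by norm_num) _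
        rw [h3] at h2
        have h4 : (0 : ℝ) < 2 ^ (2 * ν) := by positivity
        rw [mul_div_assoc', mul_assoc (_ * _ * _) (Real.sin θ / 2), h2]
        have := Real.sqrt_pos.2 Real.pi_pos
        generalize beta (ν + 1 / 2) (ν + 1 / 2) = Bt at hB ⊢
        field_simp
      · rw [Set.indicator_of_notMem hθ, Pi.mul_apply,
          if_neg (show ¬(0 < θ ∧ θ < Real.pi) from hθ)]
        simp
    · intro θ _
      have := (((Real.hasDerivAt_cos θ).const_add 1).div_const 2).hasDerivWithinAt
        (s := Set.Ioo 0 Real.pi)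
      exact this
    · intro x hx y hy h
      have h' : (1 + Real.cos x) / 2 = (1 + Real.cos y) / 2 := h
      exact Real.injOn_cos ⟨hx.1.le, hx.2.le⟩ ⟨hy.1.le, hy.2.le⟩ (by linarith)
  have h1 := hC (fun _ => 1) measurable_const
  simp only [lintegral_const, measure_univ, mul_one] at h1
  refine Measure.ext_of_lintegral _ fun f hf => ?_
  rw [lintegral_map hf (by fun_prop), hC f hf, ← h1, one_mul]

/-- A finite measure on `[0, 1]` is determined by its moments. -/
theorem measure_ext_of_moments {μ ν : Measure ℝ} [IsFiniteMeasure μ] [IsFiniteMeasure ν]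
    (hμ : ∀ᵐ x ∂μ, x ∈ Set.Icc (0 : ℝ) 1) (hν : ∀ᵐ x ∂ν, x ∈ Set.Icc (0 : ℝ) 1)
    (h : ∀ k : ℕ, ∫⁻ x, ENNReal.ofReal x ^ k ∂μ = ∫⁻ x, ENNReal.ofReal x ^ k ∂ν) : μ = ν := by
  have hmom : ∀ (ρ : Measure ℝ), (∀ᵐ x ∂ρ, x ∈ Set.Icc (0 : ℝ) 1) → ∀ k : ℕ,
      ∫ x, x ^ k ∂ρ = (∫⁻ x, ENNReal.ofReal x ^ k ∂ρ).toReal := by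
    intro ρ hρ k
    rw [integral_eq_lintegral_of_nonneg_ae]
    · congr 1
      refine lintegral_congr_ae ?_
      filter_upwards [hρ] with x hx
      rw [ENNReal.ofReal_pow hx.1]
    · filter_upwards [hρ] with x hx using pow_nonneg hx.1 k
    · exact (by fun_prop : Measurable fun x : ℝ => x ^ k).aestronglyMeasurable
  have hint : ∀ (ρ : Measure ℝ) [IsFiniteMeasure ρ], (∀ᵐ x ∂ρ, x ∈ Set.Icc (0 : ℝ) 1) →
      ∀ f : ℝ → ℝ, Continuous f → Integrable f ρ := by
    intro ρ _ hρ f hf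
    obtain ⟨M, hM⟩ := isCompact_Icc.exists_bound_of_continuousOn (s := Set.Icc (0 : ℝ) 1)
      hf.continuousOn
    refine Integrable.of_bound hf.aestronglyMeasurable M ?_
    filter_upwards [hρ] with x hx using hM x hx
  have hpoly : ∀ p : Polynomial ℝ, ∫ x, p.eval x ∂μ = ∫ x, p.eval x ∂ν := by
    intro p
    induction p using Polynomial.induction_on' with
    | add p q hp hq =>
      simp only [Polynomial.eval_add]
      rw [integral_add (hint μ hμ _ p.continuous) (hint μ hμ _ q.continuous),
        integral_add (hint ν hν _ p.continuous) (hint ν hν _ q.continuous), hp, hq]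
    | monomial n a =>
      simp only [Polynomial.eval_monomial]
      rw [integral_const_mul, integral_const_mul, hmom μ hμ, hmom ν hν, h]
  -- Equal moments give equal integrals of polynomials; Weierstrass approximation on `[0, 1]` passes
  -- to bounded continuous functions.
  refine ext_of_forall_integral_eq_of_IsFiniteMeasure fun f => ?_
  have hmass : ∀ (ρ : Measure ℝ) [IsFiniteMeasure ρ], (∀ᵐ x ∂ρ, x ∈ Set.Icc (0 : ℝ) 1) →
      ∀ (ε : ℝ) (p : Polynomial ℝ), (∀ x ∈ Set.Icc (0 : ℝ) 1, |p.eval x - f x| < ε) →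
      |∫ x, p.eval x ∂ρ - ∫ x, f x ∂ρ| ≤ ε * ρ.real Set.univ := by
    intro ρ _ hρ ε p hp
    rw [← integral_sub (hint ρ hρ _ p.continuous) (hint ρ hρ _ f.continuous)]
    rw [← Real.norm_eq_abs]
    refine norm_integral_le_of_norm_le_const ?_
    filter_upwards [hρ] with x hx using (hp x hx).le
  refine eq_of_forall_dist_le fun ε hε => ?_
  -- The two masses bound the total approximation error; adding `1` keeps `ε / M` meaningful when
  -- both vanish.
  set M := μ.real Set.univ + ν.real Set.univ + 1 with hM
  have hμ0 : 0 ≤ μ.real Set.univ := measureReal_nonneg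
  have hν0 : 0 ≤ ν.real Set.univ := measureReal_nonneg
  have hMpos : 0 < M := by positivity
  obtain ⟨p, hp⟩ := exists_polynomial_near_of_continuousOn 0 1 f f.continuous.continuousOn
    (ε / M) (by positivity)
  have h1 := hmass μ hμ _ p hp
  have h2 := hmass ν hν _ p hp
  rw [hpoly p] at h1
  rw [Real.dist_eq]
  have h3 : ε / M * μ.real Set.univ + ε / M * ν.real Set.univ ≤ ε := by
    rw [← mul_add, div_mul_eq_mul_div, div_le_iff₀ hMpos]
    exact mul_le_mul_of_nonneg_left (by linarith) hε.le
  rw [abs_le] at h1 h2 ⊢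
  constructor <;> linarith [h1.1, h1.2, h2.1, h2.2]

/-- The `k`-th moment of the law `Beta(a, a)`. -/
noncomputable def betaMoment (a : ℝ) (k : ℕ) : ℝ := beta (a + k) a / beta a a

theorem lintegral_pow_betaMeasure {a : ℝ} (ha : 0 < a) (k : ℕ) :
    ∫⁻ x, ENNReal.ofReal x ^ k ∂betaMeasure a a = ENNReal.ofReal (betaMoment a k) := by
  have hB := beta_pos ha ha
  rw [lintegral_betaMeasure (by fun_prop), betaMoment, div_eq_inv_mul,
    ENNReal.ofReal_mul (by positivity), ← setLIntegral_rpow_mul_one_sub_rpow (by positivity) ha,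
    ← lintegral_const_mul' _ _ ENNReal.ofReal_ne_top]
  refine setLIntegral_congr_fun measurableSet_Ioo fun x hx => ?_
  have hx0 := hx.1
  have hx1 : 0 < 1 - x := by linarith [hx.2]
  rw [← ENNReal.ofReal_pow hx0.le, ← ENNReal.ofReal_mul (by positivity),
    ← ENNReal.ofReal_mul (by positivity)]
  congr 1
  rw [show a + k - 1 = (a - 1) + k by ring, Real.rpow_add hx0, Real.rpow_natCast]
  ring

theorem betaMoment_zero {a : ℝ} (ha : 0 < a) : betaMoment a 0 = 1 := by
  have := beta_pos ha ha
  simp [betaMoment, this.ne']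

/-- The ratio of consecutive moments is all that the coefficient identities use of Beta laws. -/
theorem betaMoment_succ {a : ℝ} (ha : 0 < a) (k : ℕ) :
    betaMoment a (k + 1) = betaMoment a k * ((a + k) / (2 * a + k)) := by
  have h1 : 0 < a + k := by positivity
  have h2 : 0 < a + k + a := by positivity
  have h3 := Real.Gamma_pos_of_pos h2
  have h4 := beta_pos ha ha
  simp only [betaMoment, beta]
  push_cast
  rw [show a + (k + 1 : ℝ) = a + k + 1 by ring, show a + k + 1 + a = a + k + a + 1 by ring,
    Real.Gamma_add_one h1.ne', Real.Gamma_add_one h2.ne',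
    show 2 * a + k = a + k + a by ring]
  field_simp

theorem betaMoment_nonneg {a : ℝ} (ha : 0 < a) (k : ℕ) : 0 ≤ betaMoment a k :=
  div_nonneg (beta_pos (by positivity) ha).le (beta_pos ha ha).le

theorem ae_betaMeasure_mem_Ioo (a b : ℝ) :
    ∀ᵐ x ∂betaMeasure a b, x ∈ Set.Ioo (0 : ℝ) 1 := by
  rw [betaMeasure, ae_withDensity_iff (by unfold betaPDF; fun_prop)]
  refine Filter.Eventually.of_forall fun x hx => ?_
  by_contra h
  exact hx (by rw [betaPDF_eq, if_neg (show ¬(0 < x ∧ x < 1) from h)]; simp)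

end LawIdentities

/-! ### The squared Bessel clock is a Gamma variable. -/

section Clock

variable {Ω : Type*} [MeasurableSpace Ω] {P : Measure Ω}

/-- Induction with the convolution rule, for which it is enough that each term is independent of the
preceding partial sum. It starts at `d = 1` to keep the shape parameter positive. -/
theorem hasLaw_sum_gammaMeasure {Q : ℕ → Ω → ℝ} {d : ℕ} (hd : 1 ≤ d)
    (hQ : ∀ i, i < d → HasLaw (Q i) (gammaMeasure (1 / 2) 1) P)
    (hind : ∀ i, 1 ≤ i → i < d → IndepFun (fun ω => ∑ j ∈ Finset.range i, Q j ω) (Q i) P) :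
    HasLaw (fun ω => ∑ i ∈ Finset.range d, Q i ω) (gammaMeasure ((d : ℝ) / 2) 1) P := by
  induction d, hd using Nat.le_induction with
  | base => simpa using hQ 0 one_pos
  | succ n hn ih =>
    have h1 := ih (fun i hi => hQ i (by omega)) (fun i h hi => hind i h (by omega))
    have h2 := hQ n (by omega)
    have h3 := hind n hn (by omega)
    have := isProbabilityMeasure_gammaMeasure (show (0 : ℝ) < n / 2 by positivity) one_pos
    have := isProbabilityMeasure_gammaMeasure (show (0 : ℝ) < 1 / 2 by positivity) one_pos
    have h4 := h3.hasLaw_add h1 h2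
    rw [gammaMeasure_conv_gammaMeasure (by positivity) (by positivity)] at h4
    convert h4 using 1
    · ext ω
      simp [Finset.sum_range_succ]
    · congr 1
      push_cast
      ring

theorem hasLaw_sq_besselProcess [IsProbabilityMeasure P] {d : ℕ} (hd : 1 ≤ d) {B : Fin d → ℝ≥0 → Ω → ℝ}
    (hB : ∀ i, IsBrownianReal (B i) P) (hB_indep : iIndepFun (fun i ω s => B i s ω) P)
    {t : ℝ≥0} (ht : 0 < t) :
    HasLaw (fun ω => besselProcess B t ω ^ 2 / (2 * t)) (gammaMeasure ((d : ℝ) / 2) 1) P := by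
  have hlaw : ∀ i, HasLaw (fun ω => B i t ω ^ 2 / (2 * t)) (gammaMeasure (1 / 2) 1) P := by
    intro i
    have h1 := (hB i).hasLaw_eval t
    have h2 : HasLaw (fun z : ℝ => z ^ 2 / (2 * (t : ℝ))) (gammaMeasure (1 / 2) 1)
        (gaussianReal 0 t) := ⟨by fun_prop, map_sq_div_gaussianReal ht⟩
    exact h2.fun_comp h1
  have hind : iIndepFun (fun i ω => B i t ω ^ 2 / (2 * t)) P :=
    hB_indep.comp (fun _ (f : ℝ≥0 → ℝ) => f t ^ 2 / (2 * (t : ℝ))) fun _ => by fun_prop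
  -- Extension by zero to all indices, to turn the sum over `Fin d` into one over a range.
  set Q : ℕ → Ω → ℝ := fun i ω => if h : i < d then B ⟨i, h⟩ t ω ^ 2 / (2 * t) else 0 with hQ
  have hQi : ∀ i (h : i < d), Q i = fun ω => B ⟨i, h⟩ t ω ^ 2 / (2 * t) := by
    intro i h
    ext ω
    simp [hQ, h]
  have hsum := hasLaw_sum_gammaMeasure (P := P) (Q := Q) hd
    (fun i hi => by rw [hQi i hi]; exact hlaw ⟨i, hi⟩) ?_
  · refine hsum.congr (Filter.Eventually.of_forall fun ω => ?_)
    simp only [besselProcess]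
    rw [Real.sq_sqrt (Finset.sum_nonneg fun i _ => sq_nonneg _), Finset.sum_div,
      Finset.sum_range]
    exact Finset.sum_congr rfl fun i _ => by rw [hQi i i.2]
  · intro i _ hi
    have hnot : (⟨i, hi⟩ : Fin d) ∉ (Finset.univ.filter fun j : Fin d => (j : ℕ) < i) := by simp
    have h := hind.indepFun_finsetSum_of_notMem₀ (fun j => (hlaw j).aemeasurable) hnot
    rw [hQi i hi]
    convert h using 1
    ext ω
    rw [Finset.sum_apply]
    refine (Finset.sum_bij (fun (j : Fin d) _ => (j : ℕ)) ?_ ?_ ?_ ?_).symm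
    · intro j hj
      simpa using hj
    · intro j _ k _ hjk
      exact Fin.ext hjk
    · intro j hj
      have hj' : j < i := by simpa using hj
      exact ⟨⟨j, by omega⟩, by simpa using hj', rfl⟩
    · intro j _
      rw [hQi j j.2]

end Clock

/-! ### From a Gamma clock to the Beta mixture of Gaussians. -/

section Mixture

theorem lintegral_gaussianReal_comp_mul {σ : ℝ} (hσ : 0 < σ) {f : ℝ → ℝ≥0∞} (hf : Measurable f) :
    ∫⁻ z, f (σ * z) ∂gaussianReal 0 1 =
      ∫⁻ x, ENNReal.ofReal (Real.exp (-(x ^ 2 / (2 * σ ^ 2))) / (√(2 * Real.pi) * σ)) * f x := by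
  rw [gaussianReal_of_var_ne_zero _ one_ne_zero,
    lintegral_withDensity_eq_lintegral_mul _ (by fun_prop) (by fun_prop)]
  have h := setLIntegral_preimage_affine hσ 0 Set.univ MeasurableSet.univ fun x =>
    ENNReal.ofReal (Real.exp (-(x ^ 2 / (2 * σ ^ 2))) / (√(2 * Real.pi) * σ)) * f x
  simp only [Set.preimage_univ, Measure.restrict_univ, add_zero] at h
  rw [h]
  congr 1
  ext z
  simp only [Pi.mul_apply, gaussianPDF, gaussianPDFReal]
  rw [← mul_assoc, ← ENNReal.ofReal_mul hσ.le]
  congr 2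
  have : 0 < √(2 * Real.pi) := by positivity
  rw [NNReal.coe_one, sub_zero, mul_one, neg_div,
    show (σ * z) ^ 2 / (2 * σ ^ 2) = z ^ 2 / 2 by field_simp]
  field_simp

theorem measurable_betaGaussianMixture_integrand (d : ℕ) (v c t : ℝ) :
    Measurable fun p : ℝ × ℝ => ENNReal.ofReal
        (p.2 ^ ((d : ℝ) / 2 - 1) * (1 - p.2) ^ (v - (d : ℝ) / 2) *
          (Real.exp (-(p.1 ^ 2 / (2 * c ^ 2 * t * p.2))) /
            (Real.sqrt (2 * Real.pi * t * p.2) * c))) := by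
  fun_prop

theorem measurable_betaGaussianMixtureDensity (d : ℕ) (v c t : ℝ) :
    Measurable (betaGaussianMixtureDensity d v c t) := by
  unfold betaGaussianMixtureDensity
  exact ((measurable_betaGaussianMixture_integrand d v c t).lintegral_prod_right').const_mul _

/-- The law of `c √(2 t G) (2 U - 1)`, for independent `G ~ Gamma(d / 2)` and
`U ~ Beta(v + 1 / 2, v + 1 / 2)`, is the Beta mixture of centered Gaussian laws. -/
theorem lintegral_gammaMeasure_eq_betaGaussianMixture {d : ℕ} (hd : 1 ≤ d) {v c t : ℝ}
    (hc : 0 < c) (ht : 0 < t) (hv : (d : ℝ) / 2 - 1 < v) {f : ℝ → ℝ≥0∞} (hf : Measurable f) :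
    ∫⁻ g, ∫⁻ u, f (c * √(2 * t * g) * (2 * u - 1)) ∂betaMeasure (v + 1 / 2) (v + 1 / 2)
        ∂gammaMeasure ((d : ℝ) / 2) 1
      = ∫⁻ x, f x ∂volume.withDensity (betaGaussianMixtureDensity d v c t) := by
  have hd' : (1 : ℝ) ≤ d := by exact_mod_cast hd
  have ha : 0 < (d : ℝ) / 2 := by positivity
  have hb : 0 < v - (d : ℝ) / 2 + 1 := by linarith
  have hv' : 0 < v + 1 / 2 := by linarith
  have hB := beta_pos ha hb
  have := isProbabilityMeasureBeta ha hb
  have := isProbabilityMeasureBeta hv' hv'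
  have := isProbabilityMeasure_gammaMeasure (show 0 < (d : ℝ) / 2 + (v - (d : ℝ) / 2 + 1) by
    linarith) one_pos
  -- The Gamma(d/2) variable is split as Gamma(v + 1) times a Beta variable `w`, and `w` is moved
  -- outermost.
  rw [← lintegral_gammaMeasure_betaMeasure ha hb
      (F := fun g => ∫⁻ u, f (c * √(2 * t * g) * (2 * u - 1)) ∂betaMeasure (v + 1 / 2) (v + 1 / 2))
      (Measurable.lintegral_prod_right'
        (f := fun p : ℝ × ℝ => f (c * √(2 * t * p.1) * (2 * p.2 - 1))) (by fun_prop)),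
    lintegral_lintegral_swap]
  swap
  · exact (Measurable.lintegral_prod_right'
      (f := fun p : (ℝ × ℝ) × ℝ => f (c * √(2 * t * (p.1.1 * p.1.2)) * (2 * p.2 - 1)))
      (by fun_prop)).aemeasurable
  have h1 : ∀ᵐ w ∂betaMeasure ((d : ℝ) / 2) (v - (d : ℝ) / 2 + 1),
      ∫⁻ g, ∫⁻ u, f (c * √(2 * t * (g * w)) * (2 * u - 1)) ∂betaMeasure (v + 1 / 2) (v + 1 / 2)
        ∂gammaMeasure ((d : ℝ) / 2 + (v - (d : ℝ) / 2 + 1)) 1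
      = ∫⁻ x, ENNReal.ofReal (Real.exp (-(x ^ 2 / (2 * c ^ 2 * t * w))) /
          (√(2 * Real.pi * t * w) * c)) * f x := by
    filter_upwards [ae_betaMeasure_mem_Ioo _ _] with w hw
    have hw0 := hw.1
    have h2 : ∀ g u, c * √(2 * t * (g * w)) * (2 * u - 1)
        = c * √(t * w) * (√(2 * g) * (2 * u - 1)) := by
      intro g u
      rw [show 2 * t * (g * w) = (t * w) * (2 * g) by ring, Real.sqrt_mul (by positivity)]
      ring
    simp_rw [h2]
    -- The second Beta parameter was chosen for this match: the shape `v + 1` exceeds the Beta index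
    -- `v + 1/2` of `U` by `1/2`, as the Gaussian identity requires.
    rw [show (d : ℝ) / 2 + (v - (d : ℝ) / 2 + 1) = v + 1 / 2 + 1 / 2 by ring,
      lintegral_gammaMeasure_betaMeasure_symm hv' (F := fun x => f (c * √(t * w) * x))
        (by fun_prop), lintegral_gaussianReal_comp_mul (by positivity) hf]
    congr 1
    ext x
    rw [mul_pow, Real.sq_sqrt (by positivity), show 2 * Real.pi * t * w = 2 * Real.pi * (t * w) by
      ring, Real.sqrt_mul (by positivity : 0 ≤ 2 * Real.pi) (t * w)]
    congr 3
    · congr 3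
      ring
    · ring
  rw [lintegral_congr_ae h1, lintegral_betaMeasure (Measurable.lintegral_prod_right'
      (f := fun p : ℝ × ℝ => ENNReal.ofReal (Real.exp (-(p.2 ^ 2 / (2 * c ^ 2 * t * p.1))) /
          (√(2 * Real.pi * t * p.1) * c)) * f p.2) (by fun_prop)),
    lintegral_withDensity_eq_lintegral_mul _ (measurable_betaGaussianMixtureDensity d v c t) hf]
  simp_rw [← lintegral_const_mul' _ _ ENNReal.ofReal_ne_top]
  rw [lintegral_lintegral_swap (by fun_prop)]
  congr 1
  ext x
  rw [Pi.mul_apply, betaGaussianMixtureDensity,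
    ← lintegral_const_mul _ (by fun_prop), ← lintegral_mul_const _ (by fun_prop)]
  refine setLIntegral_congr_fun measurableSet_Ioo fun w hw => ?_
  have hw0 := hw.1
  have hw1 : 0 < 1 - w := by linarith [hw.2]
  rw [← mul_assoc, ← ENNReal.ofReal_mul (by positivity), ← ENNReal.ofReal_inv_of_pos hB,
    ← ENNReal.ofReal_mul (by positivity)]
  congr 2
  rw [show v - (d : ℝ) / 2 + 1 - 1 = v - (d : ℝ) / 2 by ring]
  ring

end Mixture

/-! ### Convolution identities for Beta moments. -/

section Coefficients

/-- The recurrences characterise the coefficients of `(1 - z)^(-x)`, `(1 - z)^(-y)` and `(1 -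
z)^(-(x+y))`. The induction applies the Leibniz rule for `z d/dz`: on the antidiagonal, the factor
`k + 1` splits as `p.1 + p.2`. -/
theorem sum_antidiagonal_mul_eq_of_recurrence {x y : ℝ} {f g h : ℕ → ℝ}
    (hf0 : f 0 = 1) (hg0 : g 0 = 1) (hh0 : h 0 = 1)
    (hf : ∀ k : ℕ, (k + 1) * f (k + 1) = (x + k) * f k)
    (hg : ∀ k : ℕ, (k + 1) * g (k + 1) = (y + k) * g k)
    (hh : ∀ k : ℕ, (k + 1) * h (k + 1) = (x + y + k) * h k) (k : ℕ) :
    ∑ p ∈ Finset.HasAntidiagonal.antidiagonal k, f p.1 * g p.2 = h k := by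
  induction k with
  | zero => simp [hf0, hg0, hh0]
  | succ k ih =>
    have hk : (0 : ℝ) < k + 1 := by positivity
    have h1 : ((k : ℝ) + 1) * ∑ p ∈ Finset.HasAntidiagonal.antidiagonal (k + 1), f p.1 * g p.2
        = ∑ p ∈ Finset.HasAntidiagonal.antidiagonal (k + 1), (p.1 : ℝ) * f p.1 * g p.2
          + ∑ p ∈ Finset.HasAntidiagonal.antidiagonal (k + 1), f p.1 * ((p.2 : ℝ) * g p.2) := by
      rw [Finset.mul_sum, ← Finset.sum_add_distrib]
      refine Finset.sum_congr rfl fun p hp => ?_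
      have : (p.1 : ℝ) + p.2 = k + 1 := by exact_mod_cast Finset.HasAntidiagonal.mem_antidiagonal.1 hp
      rw [← this]
      ring
    rw [Finset.Nat.sum_antidiagonal_succ (f := fun p => (p.1 : ℝ) * f p.1 * g p.2),
      Finset.Nat.sum_antidiagonal_succ' (f := fun p => f p.1 * ((p.2 : ℝ) * g p.2))] at h1
    simp only [Nat.cast_zero, zero_mul, mul_zero, zero_add, Nat.cast_add, Nat.cast_one, hf, hg,
      ← Finset.sum_add_distrib] at h1
    have h2 : ∑ p ∈ Finset.HasAntidiagonal.antidiagonal k, ((x + p.1) * f p.1 * g p.2 + f p.1 * ((y + p.2) * g p.2))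
        = (x + y + k) * ∑ p ∈ Finset.HasAntidiagonal.antidiagonal k, f p.1 * g p.2 := by
      rw [Finset.mul_sum]
      refine Finset.sum_congr rfl fun p hp => ?_
      have : (p.1 : ℝ) + p.2 = k := by exact_mod_cast Finset.HasAntidiagonal.mem_antidiagonal.1 hp
      rw [← this]
      ring
    rw [h2, ih, ← hh] at h1
    exact mul_left_cancel₀ hk.ne' h1

/-- The coefficient of `z ^ k` in `C(z / 4) ^ r`, where `C` is the generating function of the
Catalan numbers. -/
noncomputable def catalanPowCoeff (r k : ℕ) : ℝ :=
  match k, r with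
  | 0, _ => 1
  | _ + 1, 0 => 0
  | k + 1, r + 1 => catalanPowCoeff r (k + 1) + catalanPowCoeff (r + 2) k / 4
termination_by (k, r)

theorem catalanPowCoeff_zero (r : ℕ) : catalanPowCoeff r 0 = 1 := by
  rw [catalanPowCoeff]

theorem catalanPowCoeff_zero_succ (k : ℕ) : catalanPowCoeff 0 (k + 1) = 0 := by
  rw [catalanPowCoeff]

theorem catalanPowCoeff_succ_succ (r k : ℕ) : catalanPowCoeff (r + 1) (k + 1)
    = catalanPowCoeff r (k + 1) + catalanPowCoeff (r + 2) k / 4 := by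
  rw [catalanPowCoeff]

/-- This is `C^r C^q = C^(r+q)`: both sides obey the recursion coming from `C = 1 + (z/4) C²`,
multiplied by `C^r`, and agree at `r = 0`. -/
theorem sum_antidiagonal_catalanPowCoeff (q k r : ℕ) :
    ∑ p ∈ Finset.HasAntidiagonal.antidiagonal k, catalanPowCoeff r p.1 * catalanPowCoeff q p.2
      = catalanPowCoeff (r + q) k := by
  induction k generalizing r with
  | zero => simp [catalanPowCoeff_zero]
  | succ k ih =>
    induction r with
    | zero =>
      rw [Finset.Nat.sum_antidiagonal_succ]
      simp [catalanPowCoeff_zero, catalanPowCoeff_zero_succ]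
    | succ r ihr =>
      rw [Finset.Nat.sum_antidiagonal_succ] at ihr ⊢
      simp only [catalanPowCoeff_succ_succ, add_mul, Finset.sum_add_distrib,
        catalanPowCoeff_zero] at ihr ⊢
      rw [← add_assoc, ihr, show r + 1 + q = r + q + 1 by ring, catalanPowCoeff_succ_succ,
        show r + q + 2 = r + 2 + q by ring, ← ih (r + 2), Finset.sum_div]
      congr 1
      exact Finset.sum_congr rfl fun p _ => by ring

/-- The ballot-number formula for the coefficients of powers of the Catalan series, denominators
cleared. -/
theorem catalanPowCoeff_mul_factorial (k r : ℕ) :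
    catalanPowCoeff (r + 1) k * (4 ^ k * (r + 1 + k).factorial * k.factorial)
      = (r + 1) * (r + 2 * k).factorial := by
  induction k generalizing r with
  | zero =>
    rw [catalanPowCoeff_zero]
    simp [Nat.factorial_succ]
  | succ k ih =>
    induction r with
    | zero =>
      have h := ih 1
      rw [catalanPowCoeff_succ_succ, catalanPowCoeff_zero_succ]
      simp only [Nat.factorial_succ, show 0 + 1 + (k + 1) = k + 1 + 1 by ring,
        show 1 + 1 + k = k + 1 + 1 by ring, show 0 + 2 * (k + 1) = 2 * k + 1 + 1 by ring,
        show 1 + 2 * k = 2 * k + 1 by ring, show 0 + 2 = 1 + 1 by norm_num, pow_succ] at h ⊢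
      push_cast at h ⊢
      linear_combination ((k : ℝ) + 1) * h
    | succ r ihr =>
      have h := ih (r + 2)
      rw [catalanPowCoeff_succ_succ]
      simp only [show r + 1 + 1 + (k + 1) = r + k + 2 + 1 by ring,
        show r + 1 + (k + 1) = r + k + 2 by ring, show r + 2 + 1 + k = r + k + 2 + 1 by ring,
        show r + 1 + 2 = r + 2 + 1 by ring,
        show r + 2 * (k + 1) = r + 2 * k + 2 by ring, show r + 2 + 2 * k = r + 2 * k + 2 by ring,
        show r + 1 + 2 * (k + 1) = r + 2 * k + 2 + 1 by ring, pow_succ] at h ihr ⊢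
      rw [Nat.factorial_succ (r + k + 2), Nat.factorial_succ k] at *
      rw [Nat.factorial_succ (r + 2 * k + 2)]
      push_cast at h ihr ⊢
      linear_combination ((r : ℝ) + k + 3) * ihr + ((k : ℝ) + 1) * h

theorem catalanPowCoeff_succ_right (r k : ℕ) :
    catalanPowCoeff (r + 1) (k + 1) * (4 * ((r : ℝ) + 2 + k) * (k + 1))
      = catalanPowCoeff (r + 1) k * (((r : ℝ) + 1 + 2 * k) * (r + 2 + 2 * k)) := by
  have h1 := catalanPowCoeff_mul_factorial (k + 1) r
  have h2 := catalanPowCoeff_mul_factorial k r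
  have hpos : (0 : ℝ) < 4 ^ k * (r + 1 + k).factorial * k.factorial := by positivity
  refine mul_right_cancel₀ hpos.ne' ?_
  rw [show r + 1 + (k + 1) = r + 1 + k + 1 by ring,
    show r + 2 * (k + 1) = r + 2 * k + 1 + 1 by ring, Nat.factorial_succ (r + 1 + k),
    Nat.factorial_succ k, Nat.factorial_succ (r + 2 * k + 1), Nat.factorial_succ (r + 2 * k),
    pow_succ] at h1
  push_cast at h1
  linear_combination h1 - (((r : ℝ) + 1 + 2 * k) * (r + 2 + 2 * k)) * h2

/-- The Beta parameter of the law of the position, given `n` events. -/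
noncomputable def betaIndex (m : Fin 2) (n : ℕ) : ℝ := motionIndex m n + 1 / 2

theorem betaIndex_pos (m : Fin 2) (n : ℕ) : 0 < betaIndex m n := by
  unfold betaIndex motionIndex
  split_ifs <;> positivity

theorem betaIndex_zero (m : Fin 2) : betaIndex m 0 = ((m : ℕ) : ℝ) + 1 / 2 := by
  fin_cases m <;> simp [betaIndex, motionIndex]

theorem cast_choose_add_succ (n k : ℕ) :
    ((n + (k + 1)).choose (k + 1) : ℝ) * (k + 1) = (n + k).choose k * (n + k + 1) := by
  have h := Nat.add_one_mul_choose_eq (n + k) k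
  have h' : ((n + k + 1 : ℕ) : ℝ) * (n + k).choose k = (n + k + 1).choose (k + 1) * (k + 1 : ℕ) := by
    exact_mod_cast h
  rw [show n + (k + 1) = n + k + 1 by ring]
  push_cast at h'
  linarith

/-- This is `G_0 G_n = G_{n+1}` for the series `G_n` with coefficients `F n k`. For `m = 0`, `G_n =
(1 - z)^(-(n+1)/2)`; for `m = 1`, `G_n = C(z/4)^(2n+2)` with `C` the Catalan series. Each is
recognised from the ratio of consecutive coefficients. -/
theorem sum_antidiagonal_choose_mul_betaMoment (m : Fin 2) (n k : ℕ) :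
    ∑ p ∈ Finset.HasAntidiagonal.antidiagonal k, betaMoment (betaIndex m 0) p.1 *
        ((n + p.2).choose p.2 * betaMoment (betaIndex m n) p.2)
      = (n + 1 + k).choose k * betaMoment (betaIndex m (n + 1)) k := by
  have hrec : ∀ n k : ℕ, ((n + (k + 1)).choose (k + 1) * betaMoment (betaIndex m n) (k + 1) : ℝ)
      * ((k + 1) * (2 * betaIndex m n + k)) = ((n + k).choose k * betaMoment (betaIndex m n) k) *
        ((n + k + 1) * (betaIndex m n + k)) := by
    intro n k
    have h0 := betaIndex_pos m n
    have h1 : 0 < 2 * betaIndex m n + k := by positivity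
    rw [betaMoment_succ h0]
    have h2 := cast_choose_add_succ n k
    have h3 := div_mul_cancel₀ (betaIndex m n + k) h1.ne'
    linear_combination (betaMoment (betaIndex m n) k * (betaIndex m n + k)) * h2 +
      ((n + (k + 1)).choose (k + 1) * betaMoment (betaIndex m n) k * (k + 1)) * h3
  have hzero : ∀ n : ℕ, ((n + 0).choose 0 * betaMoment (betaIndex m n) 0 : ℝ) = 1 := by
    intro n
    simp [betaMoment_zero (betaIndex_pos m n)]
  set F : ℕ → ℕ → ℝ := fun n k => (n + k).choose k * betaMoment (betaIndex m n) k with hF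
  have hfirst : ∀ k : ℕ, betaMoment (betaIndex m 0) k = F 0 k := by simp [hF]
  suffices h : ∑ p ∈ Finset.HasAntidiagonal.antidiagonal k, F 0 p.1 * F n p.2 = F (n + 1) k by
    refine Eq.trans (Finset.sum_congr rfl fun p _ => ?_) h
    rw [hfirst]
  obtain rfl | rfl : m = 0 ∨ m = 1 := by omega
  · have hind : ∀ n : ℕ, betaIndex 0 n = (n + 1) / 2 := by
      intro n
      simp [betaIndex, motionIndex]
      ring
    have hF1 : ∀ n k : ℕ, (k + 1) * F n (k + 1) = (((n : ℝ) + 1) / 2 + k) * F n k := by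
      intro n k
      have h := hrec n k
      rw [hind] at h
      -- Here `2 * betaIndex 0 n + k = n + k + 1`, so the moment denominator cancels the binomial
      -- ratio.
      have hpos : (0 : ℝ) < n + k + 1 := by positivity
      refine mul_left_cancel₀ hpos.ne' ?_
      simp only [hF, hind]
      linear_combination h
    refine sum_antidiagonal_mul_eq_of_recurrence (x := 1 / 2) (y := ((n : ℝ) + 1) / 2)
      (hzero 0) (hzero n) (hzero (n + 1)) (fun k => ?_) (hF1 n) (fun k => ?_) k
    · rw [hF1]
      push_cast
      ring
    · rw [hF1]
      push_cast
      ring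
  · have hind : ∀ n : ℕ, betaIndex 1 n = n + 3 / 2 := by
      intro n
      simp [betaIndex, motionIndex]
      ring
    have hF1 : ∀ n k : ℕ, F n k = catalanPowCoeff (2 * n + 1 + 1) k := by
      intro n k
      induction k with
      | zero => rw [catalanPowCoeff_zero]; exact hzero n
      | succ k ih =>
        have h := hrec n k
        have h' := catalanPowCoeff_succ_right (2 * n + 1) k
        rw [← ih] at h'
        simp only [hind] at h
        have hpos : (0 : ℝ) < 4 * (2 * n + 3 + k) * (k + 1) := by positivity
        refine mul_right_cancel₀ hpos.ne' ?_
        simp only [hF, hind] at h' ⊢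
        push_cast at h' ⊢
        linear_combination 4 * h - h'
    simp_rw [hF1]
    rw [sum_antidiagonal_catalanPowCoeff]
    congr 1
    ring

end Coefficients

/-! ### Moments of the weighted sum on `n` Poisson events. -/

section PoissonMoments

/-- The `k`-th power of the weighted sum `∑ (s_{j+1} - s_j) u_j` on the event that exactly `n`
of the times with increments `τ` occur up to time `s`, and zero elsewhere. -/
noncomputable def weightedPow (n k : ℕ) (s : ℝ) (τ u : Fin (n + 1) → ℝ) : ℝ≥0∞ :=
  if ∑ j : Fin n, τ j.castSucc ≤ s ∧ s < ∑ j : Fin n, τ j.castSucc + τ (Fin.last n) then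
    (∑ j : Fin n, ENNReal.ofReal (τ j.castSucc) * ENNReal.ofReal (u j.castSucc) +
      ENNReal.ofReal (s - ∑ j : Fin n, τ j.castSucc) * ENNReal.ofReal (u (Fin.last n))) ^ k
  else 0

theorem measurable_weightedPow {α : Type*} [MeasurableSpace α] {n : ℕ} (k : ℕ) {s : α → ℝ}
    {τ u : α → Fin (n + 1) → ℝ} (hs : Measurable s) (hτ : Measurable τ) (hu : Measurable u) :
    Measurable fun a => weightedPow n k (s a) (τ a) (u a) := by
  unfold weightedPow
  have h (j) : Measurable fun a => τ a j := (measurable_pi_apply j).comp hτ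
  have h' (j) : Measurable fun a => u a j := (measurable_pi_apply j).comp hu
  refine Measurable.ite ?_ (by fun_prop) measurable_const
  exact (measurableSet_le (by fun_prop) hs).inter (measurableSet_lt hs (by fun_prop))

/-- Renewal step: after the first period of length `x`, the same functional restarts with horizon `s
- x`, and the binomial theorem separates the contribution `x y` of that period. -/
theorem weightedPow_cons (n k : ℕ) (s x y : ℝ) (τ u : Fin (n + 1) → ℝ) :
    weightedPow (n + 1) k s (Fin.cons x τ : Fin (n + 2) → ℝ) (Fin.cons y u : Fin (n + 2) → ℝ) =
      ∑ p ∈ Finset.HasAntidiagonal.antidiagonal k, (k.choose p.1 : ℝ≥0∞) *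
        (ENNReal.ofReal x ^ p.1 * (ENNReal.ofReal y ^ p.1 * weightedPow n p.2 (s - x) τ u)) := by
  have hcast : ∀ (z : ℝ) (w : Fin (n + 1) → ℝ) (j : Fin n),
      (Fin.cons z w : Fin (n + 2) → ℝ) j.succ.castSucc = w j.castSucc := by
    intro z w j
    rw [← Fin.succ_castSucc, Fin.cons_succ]
  have hlast : ∀ (z : ℝ) (w : Fin (n + 1) → ℝ),
      (Fin.cons z w : Fin (n + 2) → ℝ) (Fin.last (n + 1)) = w (Fin.last n) := by
    intro z w
    rw [← Fin.succ_last, Fin.cons_succ]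
  unfold weightedPow
  simp only [Fin.sum_univ_succ (n := n), hcast, hlast, Fin.castSucc_zero, Fin.cons_zero]
  by_cases h : ∑ j : Fin n, τ j.castSucc ≤ s - x ∧
      s - x < ∑ j : Fin n, τ j.castSucc + τ (Fin.last n)
  · rw [if_pos ⟨by linarith [h.1], by linarith [h.2]⟩]
    simp only [if_pos h]
    rw [← sub_sub, add_assoc, (Commute.all _ _).add_pow']
    refine Finset.sum_congr rfl fun p _ => ?_
    rw [nsmul_eq_mul, mul_pow, mul_assoc]
  · rw [if_neg fun h' => h ⟨by linarith [h'.1], by linarith [h'.2]⟩]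
    simp [if_neg h]

theorem lintegral_pi_fin_succ {μ : Measure ℝ} [SigmaFinite μ] {n : ℕ}
    {F : (Fin (n + 1) → ℝ) → ℝ≥0∞} (hF : Measurable F) :
    ∫⁻ τ, F τ ∂Measure.pi (fun _ => μ)
      = ∫⁻ x, ∫⁻ τ, F (Fin.cons x τ : Fin (n + 1) → ℝ) ∂Measure.pi (fun _ : Fin n => μ) ∂μ := by
  have h := (measurePreserving_piFinSuccAbove (fun _ : Fin (n + 1) => μ) 0).symm
  rw [← h.lintegral_comp hF, lintegral_prod]
  · refine lintegral_congr fun x => lintegral_congr fun τ => ?_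
    exact congrArg F (Fin.insertNth_zero' x τ)
  · exact (hF.comp h.measurable).aemeasurable

theorem beta_natCast_add_one (i q : ℕ) : beta ((i : ℝ) + 1) ((q : ℝ) + 1)
    = i.factorial * q.factorial / (i + q + 1).factorial := by
  rw [beta, Real.Gamma_nat_eq_factorial, Real.Gamma_nat_eq_factorial,
    show (i : ℝ) + 1 + (q + 1) = ((i + q + 1 : ℕ) : ℝ) + 1 by push_cast; ring,
    Real.Gamma_nat_eq_factorial]

theorem lintegral_expMeasure {r : ℝ} {f : ℝ → ℝ≥0∞} (hf : Measurable f) :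
    ∫⁻ x, f x ∂expMeasure r =
      ∫⁻ x in Set.Ioi 0, ENNReal.ofReal (r * Real.exp (-(r * x))) * f x := by
  rw [expMeasure, lintegral_gammaMeasure hf]
  refine setLIntegral_congr_fun measurableSet_Ioi fun x _ => ?_
  simp

/-- The exponentials multiply to the constant `e^(-rs)`, leaving a Beta integral over `(0, s)`. -/
theorem lintegral_expMeasure_pow_mul {r : ℝ} (hr : 0 < r) (i q : ℕ) (s : ℝ) :
    ∫⁻ x, ENNReal.ofReal x ^ i * (if 0 ≤ s - x then
        ENNReal.ofReal (Real.exp (-(r * (s - x))) * (s - x) ^ q) else 0) ∂expMeasure r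
      = if 0 ≤ s then ENNReal.ofReal (r * Real.exp (-(r * s)) *
          (s ^ (i + q + 1) * (i.factorial * q.factorial / (i + q + 1).factorial))) else 0 := by
  have hm : Measurable fun x => ENNReal.ofReal x ^ i * (if 0 ≤ s - x then
        ENNReal.ofReal (Real.exp (-(r * (s - x))) * (s - x) ^ q) else 0) := by
    refine Measurable.mul (by fun_prop) (Measurable.ite ?_ (by fun_prop) measurable_const)
    exact measurableSet_le measurable_const (by fun_prop)
  rw [lintegral_expMeasure hm]
  rcases lt_or_ge 0 s with hs | hs
  · have hsplit : Set.Ioi (0 : ℝ) = Set.Ioc 0 s ∪ Set.Ioi s := (Set.Ioc_union_Ioi_eq_Ioi hs.le).symm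
    rw [hsplit, lintegral_union measurableSet_Ioi (Set.Ioc_disjoint_Ioi le_rfl),
      setLIntegral_congr_fun (g := fun _ => 0) measurableSet_Ioi, lintegral_zero, add_zero,
      setLIntegral_congr Ioo_ae_eq_Ioc.symm, if_pos hs.le,
      ENNReal.ofReal_mul (by positivity), ← beta_natCast_add_one,
      show s ^ (i + q + 1) = s ^ ((i : ℝ) + 1 + (q + 1) - 1) by
        rw [← Real.rpow_natCast]; push_cast; ring_nf,
      ← setLIntegral_rpow_mul_sub_rpow (by positivity) (by positivity) hs,
      ← lintegral_const_mul' _ _ ENNReal.ofReal_ne_top]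
    · refine setLIntegral_congr_fun measurableSet_Ioo fun x hx => ?_
      have hx0 := hx.1
      have hx1 : 0 < s - x := by linarith [hx.2]
      simp only [if_pos hx1.le]
      rw [← ENNReal.ofReal_pow hx0.le, ← ENNReal.ofReal_mul (by positivity),
        ← ENNReal.ofReal_mul (by positivity), ← ENNReal.ofReal_mul (by positivity)]
      congr 1
      rw [add_sub_cancel_right, add_sub_cancel_right, Real.rpow_natCast, Real.rpow_natCast,
        show -(r * s) = -(r * x) + -(r * (s - x)) by ring, Real.exp_add]
      ring
    · intro x (hx : s < x)
      simp only []
      rw [if_neg (by linarith)]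
      simp
  -- At `s = 0` the right side still vanishes, because the exponent `i + q + 1` is positive.
  · have h0 : (if 0 ≤ s then ENNReal.ofReal (r * Real.exp (-(r * s)) *
          (s ^ (i + q + 1) * (i.factorial * q.factorial / (i + q + 1).factorial))) else 0) = 0 := by
      split_ifs with h
      · simp [le_antisymm hs h]
      · rfl
    rw [h0, setLIntegral_congr_fun (g := fun _ => 0) measurableSet_Ioi, lintegral_zero]
    intro x (hx : 0 < x)
    simp only []
    rw [if_neg (by linarith)]
    simp

theorem expMeasure_Ioi {r : ℝ} (hr : 0 < r) {s : ℝ} (hs : 0 ≤ s) :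
    expMeasure r (Set.Ioi s) = ENNReal.ofReal (Real.exp (-(r * s))) := by
  rw [← lintegral_indicator_one measurableSet_Ioi,
    lintegral_expMeasure (measurable_one.indicator measurableSet_Ioi)]
  have h1 := setLIntegral_sub_rpow_mul_exp one_pos (r * s)
  rw [Real.Gamma_one, one_mul] at h1
  have hpre : (fun x => r * x + 0) ⁻¹' Set.Ioi (r * s) = Set.Ioi s := by
    ext x
    simp only [Set.mem_preimage, Set.mem_Ioi, add_zero]
    exact ⟨fun h => lt_of_mul_lt_mul_left h hr.le, fun h => mul_lt_mul_of_pos_left h hr⟩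
  rw [setLIntegral_preimage_affine hr 0 _ measurableSet_Ioi, hpre] at h1
  rw [← h1, ← lintegral_indicator measurableSet_Ioi, ← lintegral_indicator measurableSet_Ioi]
  congr 1
  ext x
  by_cases hx : s < x
  · rw [Set.indicator_of_mem (show x ∈ Set.Ioi s from hx),
      Set.indicator_of_mem (show x ∈ Set.Ioi (0 : ℝ) from hs.trans_lt hx),
      Set.indicator_of_mem (show x ∈ Set.Ioi s from hx), ← ENNReal.ofReal_mul hr.le]
    simp
  · rw [Set.indicator_of_notMem (show x ∉ Set.Ioi s from hx)]
    by_cases hx0 : 0 < x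
    · rw [Set.indicator_of_mem (show x ∈ Set.Ioi (0 : ℝ) from hx0),
        Set.indicator_of_notMem (show x ∉ Set.Ioi s from hx), mul_zero]
    · rw [Set.indicator_of_notMem (show x ∉ Set.Ioi (0 : ℝ) from hx0)]

/-- Induction on `n` through the renewal step, with `k` and `s` free. Negative `s` must be allowed,
since the remaining horizon `s - x` can be negative. -/
theorem lintegral_weightedPow (m : Fin 2) {lam : ℝ} (hlam : 0 < lam) (n k : ℕ) (s : ℝ) :
    ∫⁻ τ, ∫⁻ u, weightedPow n k s τ u
        ∂Measure.pi (fun _ => betaMeasure (betaIndex m 0) (betaIndex m 0))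
        ∂Measure.pi (fun _ => expMeasure lam)
      = if 0 ≤ s then ENNReal.ofReal (lam ^ n / n.factorial * betaMoment (betaIndex m n) k *
          (Real.exp (-(lam * s)) * s ^ (n + k))) else 0 := by
  have ha := betaIndex_pos m 0
  have := isProbabilityMeasureBeta ha ha
  have := isProbabilityMeasure_expMeasure hlam
  set β := betaMeasure (betaIndex m 0) (betaIndex m 0) with hβ
  induction n generalizing k s with
  | zero =>
    have hβ1 : ∀ x : ℝ, ∫⁻ u, weightedPow 0 k s (fun _ => x) u ∂Measure.pi (fun _ => β)
        = (if 0 ≤ s then ENNReal.ofReal s ^ k * ENNReal.ofReal (betaMoment (betaIndex m 0) k)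
            else 0) * (Set.Ioi s).indicator 1 x := by
      intro x
      have hu := measurePreserving_piUnique (fun _ : Fin 1 => β)
      have h2 : ∀ u : Fin 1 → ℝ, weightedPow 0 k s (fun _ => x) u
          = (if 0 ≤ s then ENNReal.ofReal s ^ k else 0) * (Set.Ioi s).indicator 1 x *
            ENNReal.ofReal (u default) ^ k := by
        intro u
        by_cases h0 : 0 ≤ s <;> by_cases hx : s < x <;> simp [weightedPow, h0, hx, mul_pow]
      simp_rw [h2]
      rw [lintegral_const_mul _ (by fun_prop)]
      have h3 := hu.lintegral_comp (f := fun y => ENNReal.ofReal y ^ k) (by fun_prop)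
      have h4 : ∫⁻ u : Fin 1 → ℝ, ENNReal.ofReal (u default) ^ k ∂Measure.pi (fun _ => β)
          = ENNReal.ofReal (betaMoment (betaIndex m 0) k) := by
        rw [← lintegral_pow_betaMeasure ha k, ← hβ, ← h3]
        rfl
      rw [h4]
      split_ifs <;> ring
    have hτ := measurePreserving_piUnique (fun _ : Fin 1 => expMeasure lam)
    have h5 : ∀ τ : Fin 1 → ℝ, ∫⁻ u, weightedPow 0 k s τ u ∂Measure.pi (fun _ => β)
        = (if 0 ≤ s then ENNReal.ofReal s ^ k * ENNReal.ofReal (betaMoment (betaIndex m 0) k)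
            else 0) * (Set.Ioi s).indicator 1 (MeasurableEquiv.piUnique (fun _ : Fin 1 => ℝ) τ) := by
      intro τ
      have : τ = fun _ => τ default := by
        ext j
        rw [Subsingleton.elim j default]
      conv_lhs => rw [this]
      exact hβ1 (τ default)
    simp_rw [h5]
    rw [lintegral_const_mul _ (by
        exact (measurable_one.indicator measurableSet_Ioi).comp (MeasurableEquiv.measurable _)),
      hτ.lintegral_comp (measurable_one.indicator measurableSet_Ioi),
      lintegral_indicator_one measurableSet_Ioi]
    split_ifs with hs
    · rw [expMeasure_Ioi hlam hs, ← ENNReal.ofReal_pow hs, ← ENNReal.ofReal_mul (by positivity),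
        ← ENNReal.ofReal_mul (mul_nonneg (by positivity) (betaMoment_nonneg ha k))]
      congr 1
      simp
      ring
    · simp
  | succ n ih =>
    rw [lintegral_pi_fin_succ (Measurable.lintegral_prod_right'
      (f := fun p : (Fin (n + 2) → ℝ) × (Fin (n + 2) → ℝ) => weightedPow (n + 1) k s p.1 p.2)
      (measurable_weightedPow k measurable_const measurable_fst measurable_snd))]
    have hin : ∀ (x : ℝ) (τ : Fin (n + 1) → ℝ),
        ∫⁻ u, weightedPow (n + 1) k s (Fin.cons x τ : Fin (n + 2) → ℝ) u
          ∂Measure.pi (fun _ => β)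
        = ∑ p ∈ Finset.HasAntidiagonal.antidiagonal k, (k.choose p.1 : ℝ≥0∞) *
          (ENNReal.ofReal x ^ p.1 * (ENNReal.ofReal (betaMoment (betaIndex m 0) p.1) *
            ∫⁻ u, weightedPow n p.2 (s - x) τ u ∂Measure.pi (fun _ => β))) := by
      intro x τ
      have hmu : ∀ j : ℕ, Measurable fun u => weightedPow n j (s - x) τ u := fun j =>
        measurable_weightedPow j measurable_const measurable_const measurable_id
      rw [lintegral_pi_fin_succ (F := fun u => weightedPow (n + 1) k s (Fin.cons x τ) u)
        (measurable_weightedPow k measurable_const measurable_const measurable_id)]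
      simp_rw [weightedPow_cons]
      have h1 : ∀ y : ℝ, ∫⁻ u, ∑ p ∈ Finset.HasAntidiagonal.antidiagonal k, (k.choose p.1 : ℝ≥0∞) *
          (ENNReal.ofReal x ^ p.1 * (ENNReal.ofReal y ^ p.1 * weightedPow n p.2 (s - x) τ u))
            ∂Measure.pi (fun _ : Fin (n + 1) => β)
          = ∑ p ∈ Finset.HasAntidiagonal.antidiagonal k, (k.choose p.1 : ℝ≥0∞) *
          (ENNReal.ofReal x ^ p.1 * (ENNReal.ofReal y ^ p.1 *
            ∫⁻ u, weightedPow n p.2 (s - x) τ u ∂Measure.pi (fun _ => β))) := by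
        intro y
        rw [lintegral_finsetSum _ fun p _ => by
          exact ((((hmu p.2).const_mul _).const_mul _).const_mul _)]
        refine Finset.sum_congr rfl fun p _ => ?_
        rw [lintegral_const_mul _ (((hmu p.2).const_mul _).const_mul _),
          lintegral_const_mul _ ((hmu p.2).const_mul _), lintegral_const_mul _ (hmu p.2)]
      simp_rw [h1]
      rw [lintegral_finsetSum _ fun p _ => by fun_prop]
      refine Finset.sum_congr rfl fun p _ => ?_
      rw [lintegral_const_mul _ (by fun_prop), lintegral_const_mul _ (by fun_prop),
        lintegral_mul_const _ (by fun_prop), lintegral_pow_betaMeasure ha]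
    simp_rw [hin]
    have hmτ : ∀ (j : ℕ) (x : ℝ), Measurable fun τ =>
        ∫⁻ u, weightedPow n j (s - x) τ u ∂Measure.pi (fun _ => β) := fun j x =>
      Measurable.lintegral_prod_right'
        (f := fun p : (Fin (n + 1) → ℝ) × (Fin (n + 1) → ℝ) => weightedPow n j (s - x) p.1 p.2)
        (measurable_weightedPow j measurable_const measurable_fst measurable_snd)
    have hout : ∀ x : ℝ, ∫⁻ τ, ∑ p ∈ Finset.HasAntidiagonal.antidiagonal k,
          (k.choose p.1 : ℝ≥0∞) * (ENNReal.ofReal x ^ p.1 *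
          (ENNReal.ofReal (betaMoment (betaIndex m 0) p.1) *
            ∫⁻ u, weightedPow n p.2 (s - x) τ u ∂Measure.pi (fun _ => β)))
          ∂Measure.pi (fun _ => expMeasure lam)
        = ∑ p ∈ Finset.HasAntidiagonal.antidiagonal k,
          ENNReal.ofReal (k.choose p.1 * betaMoment (betaIndex m 0) p.1 *
            (lam ^ n / n.factorial * betaMoment (betaIndex m n) p.2)) *
          (ENNReal.ofReal x ^ p.1 * (if 0 ≤ s - x then
            ENNReal.ofReal (Real.exp (-(lam * (s - x))) * (s - x) ^ (n + p.2)) else 0)) := by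
      intro x
      rw [lintegral_finsetSum _ fun p _ => by
        exact ((((hmτ p.2 x).const_mul _).const_mul _).const_mul _)]
      refine Finset.sum_congr rfl fun p _ => ?_
      have hb0 := betaMoment_nonneg ha p.1
      have hbn := betaMoment_nonneg (betaIndex_pos m n) p.2
      rw [lintegral_const_mul _ (((hmτ p.2 x).const_mul _).const_mul _),
        lintegral_const_mul _ ((hmτ p.2 x).const_mul _), lintegral_const_mul _ (hmτ p.2 x),
        ih, mul_assoc (k.choose p.1 : ℝ), ENNReal.ofReal_mul (p := k.choose p.1) (by positivity),
        ENNReal.ofReal_mul hb0, ENNReal.ofReal_natCast]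
      split_ifs
      · rw [ENNReal.ofReal_mul (by positivity)]
        ring
      · simp
    simp_rw [hout]
    have hmx : ∀ i j : ℕ, Measurable fun x => (ENNReal.ofReal x ^ i * (if 0 ≤ s - x then
            ENNReal.ofReal (Real.exp (-(lam * (s - x))) * (s - x) ^ (n + j)) else 0)) := by
      intro i j
      refine Measurable.mul (by fun_prop) (Measurable.ite ?_ (by fun_prop) measurable_const)
      exact measurableSet_le measurable_const (by fun_prop)
    rw [lintegral_finsetSum _ fun p _ => (hmx p.1 p.2).const_mul _]
    simp_rw [lintegral_const_mul _ (hmx _ _), lintegral_expMeasure_pow_mul hlam]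
    split_ifs with hs
    · have hnn : ∀ p : ℕ × ℕ, 0 ≤ k.choose p.1 * betaMoment (betaIndex m 0) p.1 *
          (lam ^ n / n.factorial * betaMoment (betaIndex m n) p.2) := fun p =>
        mul_nonneg (mul_nonneg (by positivity) (betaMoment_nonneg ha p.1))
          (mul_nonneg (by positivity) (betaMoment_nonneg (betaIndex_pos m n) p.2))
      simp_rw [← ENNReal.ofReal_mul (hnn _)]
      rw [← ENNReal.ofReal_sum_of_nonneg fun p _ => mul_nonneg (hnn p) (by positivity)]
      congr 1
      -- The factorials from the time integral and from `k.choose p.1` regroup as `k! / (n + 1 +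
      -- k)!` times `(n + p.2).choose p.2`, the weight in the convolution identity.
      have hterm : ∀ p ∈ Finset.HasAntidiagonal.antidiagonal k,
          k.choose p.1 * betaMoment (betaIndex m 0) p.1 *
            (lam ^ n / n.factorial * betaMoment (betaIndex m n) p.2) *
            (lam * Real.exp (-(lam * s)) * (s ^ (p.1 + (n + p.2) + 1) *
              (p.1.factorial * (n + p.2).factorial / (p.1 + (n + p.2) + 1).factorial)))
          = (lam ^ (n + 1) * Real.exp (-(lam * s)) * s ^ (n + 1 + k) *
            (k.factorial / (n + 1 + k).factorial)) * (betaMoment (betaIndex m 0) p.1 *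
              ((n + p.2).choose p.2 * betaMoment (betaIndex m n) p.2)) := by
        intro p hp
        obtain rfl : p.1 + p.2 = k := Finset.HasAntidiagonal.mem_antidiagonal.1 hp
        rw [show p.1 + (n + p.2) + 1 = n + 1 + (p.1 + p.2) by ring, Nat.cast_add_choose,
          add_comm n p.2, Nat.cast_add_choose]
        field_simp
        ring
      rw [Finset.sum_congr rfl hterm, ← Finset.mul_sum, sum_antidiagonal_choose_mul_betaMoment,
        add_comm (n + 1) k, Nat.cast_add_choose]
      field_simp
    · simp

end PoissonMoments

/-! ### Measurability of the path functionals. -/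

section Measurability

variable {α : Type*} [MeasurableSpace α]

theorem measurable_arrivalTime {τ : ℕ → α → ℝ} (hτ : ∀ j, Measurable (τ j)) (j : ℕ) :
    Measurable (arrivalTime τ j) := by
  unfold arrivalTime
  exact Finset.measurable_fun_sum _ fun i _ => hτ i

theorem measurable_eventCount {τ : ℕ → α → ℝ} (hτ : ∀ j, Measurable (τ j)) {s : α → ℝ}
    (hs : Measurable s) : Measurable fun a => eventCount τ (s a) a := by
  set S : Set (α × ℕ) := {p | 1 ≤ p.2 ∧ arrivalTime τ p.2 p.1 ≤ s p.1} with hS_def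
  have hS : MeasurableSet S := by
    refine MeasurableSet.inter (s₁ := {p : α × ℕ | 1 ≤ p.2})
      (s₂ := {p : α × ℕ | arrivalTime τ p.2 p.1 ≤ s p.1})
      (measurableSet_le measurable_const measurable_snd) (measurableSet_le ?_ ?_)
    · exact measurable_from_prod_countable_left fun j => measurable_arrivalTime hτ j
    · exact hs.comp measurable_fst
  have h1 : Measurable fun a => Measure.count (Prod.mk a ⁻¹' S) := measurable_measure_prodMk_left hS
  -- The count is the counting measure of a section of `S`. For infinite sections `toReal` gives
  -- `0`, in agreement with `Set.ncard`.
  have h2 : (fun a => eventCount τ (s a) a)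
      = fun a => ⌊(Measure.count (Prod.mk a ⁻¹' S)).toReal⌋₊ := by
    ext a
    rw [Measure.count_apply (MeasurableSet.of_discrete)]
    have h3 : eventCount τ (s a) a = (Prod.mk a ⁻¹' S).ncard := rfl
    rw [h3, Set.ncard]
    cases h : (Prod.mk a ⁻¹' S).encard with
    | top => simp
    | coe k => simp
  rw [h2]
  exact Nat.measurable_floor.comp h1.ennreal_toReal

theorem measurable_switchTime {τ : ℕ → α → ℝ} (hτ : ∀ j, Measurable (τ j)) {s : α → ℝ}
    (hs : Measurable s) (j : ℕ) : Measurable fun a => switchTime τ (s a) j a := by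
  unfold switchTime
  exact Measurable.ite (measurableSet_le measurable_const (measurable_eventCount hτ hs))
    (measurable_arrivalTime hτ j) hs

theorem measurable_motionPosition (c : ℝ) {τ θ : ℕ → α → ℝ} (hτ : ∀ j, Measurable (τ j))
    (hθ : ∀ j, Measurable (θ j)) {s : α → ℝ} (hs : Measurable s) :
    Measurable fun a => motionPosition c τ θ (s a) a := by
  -- The random number of terms is made a separate countable variable, so that each slice is a sum
  -- of fixed length.
  have h : Measurable fun p : α × ℕ => ∑ j ∈ Finset.range (p.2 + 1),
      (switchTime τ (s p.1) (j + 1) p.1 - switchTime τ (s p.1) j p.1) * Real.cos (θ j p.1) := by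
    refine measurable_from_prod_countable_left fun k => ?_
    dsimp only
    refine Finset.measurable_fun_sum _ fun j _ => ?_
    exact ((measurable_switchTime hτ hs (j + 1)).sub (measurable_switchTime hτ hs j)).mul
      (Real.measurable_cos.comp (hθ j))
  unfold motionPosition
  exact (h.comp (measurable_id.prodMk (measurable_eventCount hτ hs))).const_mul c

end Measurability

/-! ### Conditioning on an independent clock. -/

section ConditionalLaw

variable {Ω E : Type*} [MeasurableSpace Ω] [MeasurableSpace E]

theorem map_cond_apply {μ : Measure E} {S : Set E} (hS : MeasurableSet S) {X : E → ℝ}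
    (hX : Measurable X) {A : Set ℝ} (hA : MeasurableSet A) :
    (cond μ S).map X A = (μ S)⁻¹ * μ (S ∩ X ⁻¹' A) := by
  rw [Measure.map_apply hX hA, cond_apply hS]

/-- The kernel `(n, s) ↦ law of X (s, ·) given N (s, ·) = n`. -/
noncomputable def fiberKernel (μ : Measure E) [IsProbabilityMeasure μ] {N : ℝ × E → ℕ}
    (hN : Measurable N) {X : ℝ × E → ℝ} (hX : Measurable X) : Kernel (ℕ × ℝ) ℝ where
  toFun q := (cond μ {p | N (q.2, p) = q.1}).map fun p => X (q.2, p)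
  measurable' := by
    refine Measure.measurable_of_measurable_coe _ fun A hA => ?_
    have hS : ∀ q : ℕ × ℝ, MeasurableSet {p | N (q.2, p) = q.1} := fun q =>
      measurable_prodMk_left (hN (measurableSet_singleton q.1))
    have hXs : ∀ q : ℕ × ℝ, Measurable fun p => X (q.2, p) := fun q =>
      hX.comp measurable_prodMk_left
    simp_rw [fun q : ℕ × ℝ => map_cond_apply (μ := μ) (hS q) (hXs q) hA]
    refine measurable_from_prod_countable_right fun n => ?_
    refine Measurable.mul ?_ ?_
    · exact (measurable_measure_prodMk_left (hN (measurableSet_singleton n))).inv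
    · exact measurable_measure_prodMk_left ((hN (measurableSet_singleton n)).inter (hX hA))

theorem fiberKernel_apply (μ : Measure E) [IsProbabilityMeasure μ] {N : ℝ × E → ℕ}
    (hN : Measurable N) {X : ℝ × E → ℝ} (hX : Measurable X) (n : ℕ) (s : ℝ) :
    fiberKernel μ hN hX (n, s) = (cond μ {p | N (s, p) = n}).map fun p => X (s, p) := rfl

/-- Only finite, not Markov: conditioning on a null event gives the zero measure. -/
instance isFiniteKernel_fiberKernel (μ : Measure E) [IsProbabilityMeasure μ] {N : ℝ × E → ℕ}
    (hN : Measurable N) {X : ℝ × E → ℝ} (hX : Measurable X) :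
    IsFiniteKernel (fiberKernel μ hN hX) := by
  refine ⟨⟨1, ENNReal.one_lt_top, fun q => ?_⟩⟩
  rw [← Prod.mk.eta (p := q), fiberKernel_apply,
    Measure.map_apply (show Measurable fun p => X (q.2, p) from hX.comp measurable_prodMk_left)
      MeasurableSet.univ]
  exact prob_le_one

/-- Law of total probability over the values of `N (s, ·)`. Null values contribute zero on both
sides, so the zero kernel there does no harm. -/
theorem lintegral_fiberKernel (μ : Measure E) [IsProbabilityMeasure μ] {N : ℝ × E → ℕ}
    (hN : Measurable N) {X : ℝ × E → ℝ} (hX : Measurable X) {f : (ℕ × ℝ) × ℝ → ℝ≥0∞}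
    (hf : Measurable f) (s : ℝ) :
    ∫⁻ p, ∫⁻ x, f ((N (s, p), s), x) ∂fiberKernel μ hN hX (N (s, p), s) ∂μ
      = ∫⁻ p, f ((N (s, p), s), X (s, p)) ∂μ := by
  have hNs : Measurable fun p => N (s, p) := hN.comp measurable_prodMk_left
  have hXs : Measurable fun p => X (s, p) := hX.comp measurable_prodMk_left
  have hS : ∀ n, MeasurableSet {p | N (s, p) = n} := fun n => hNs (measurableSet_singleton n)
  have hdisj : Pairwise (Function.onFun Disjoint fun n => {p | N (s, p) = n}) := by
    intro i j hij
    rw [Function.onFun, Set.disjoint_left]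
    intro p hi hj
    exact hij (hi.symm.trans hj)
  have huniv : (⋃ n, {p | N (s, p) = n}) = Set.univ := by
    ext p
    simp
  rw [← setLIntegral_univ, ← setLIntegral_univ (fun p => f ((N (s, p), s), X (s, p))), ← huniv,
    lintegral_iUnion hS hdisj, lintegral_iUnion hS hdisj]
  congr 1
  ext n
  have h1 : ∫⁻ p in {p | N (s, p) = n},
        ∫⁻ x, f ((N (s, p), s), x) ∂fiberKernel μ hN hX (N (s, p), s) ∂μ
      = ∫⁻ _ in {p | N (s, p) = n}, ∫⁻ x, f ((n, s), x) ∂fiberKernel μ hN hX (n, s) ∂μ := by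
    refine setLIntegral_congr_fun (hS n) fun p (hp : N (s, p) = n) => ?_
    simp only [hp]
  have h2 : ∫⁻ p in {p | N (s, p) = n}, f ((N (s, p), s), X (s, p)) ∂μ
      = ∫⁻ p in {p | N (s, p) = n}, f ((n, s), X (s, p)) ∂μ := by
    refine setLIntegral_congr_fun (hS n) fun p (hp : N (s, p) = n) => ?_
    simp only [hp]
  rw [h1, h2, setLIntegral_const, fiberKernel_apply, lintegral_map (by fun_prop) hXs, ProbabilityTheory.cond,
    lintegral_smul_measure, smul_eq_mul, mul_right_comm]
  by_cases h0 : μ {p | N (s, p) = n} = 0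
  · rw [Measure.restrict_eq_zero.2 h0]
    simp
  · rw [ENNReal.inv_mul_cancel h0 (measure_ne_top _ _), one_mul]

/-- Conditioning on the value of an independent clock amounts to freezing it. -/
theorem condDistrib_ae_eq_map_cond {P : Measure Ω} [IsProbabilityMeasure P] {T : Ω → E}
    {R : Ω → ℝ} (hT : AEMeasurable T P) (hR : AEMeasurable R P) (hTR : IndepFun T R P)
    {N : ℝ × E → ℕ} (hN : Measurable N) {X : ℝ × E → ℝ} (hX : Measurable X) {n : ℕ}
    (hn : ∀ᵐ s ∂P.map R, P {ω | N (s, T ω) = n} ≠ 0) :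
    ∀ᵐ s ∂P.map R, condDistrib (fun ω => X (R ω, T ω)) (fun ω => (N (R ω, T ω), R ω)) P (n, s)
      = (cond P {ω | N (s, T ω) = n}).map fun ω => X (s, T ω) := by
  have : IsProbabilityMeasure (P.map T) := Measure.isProbabilityMeasure_map hT
  have : IsProbabilityMeasure (P.map R) := Measure.isProbabilityMeasure_map hR
  have hjoint : P.map (fun ω => (R ω, T ω)) = (P.map R).prod (P.map T) :=
    (indepFun_iff_map_prod_eq_prod_map_map hR hT).1 hTR.symm
  have hRT : AEMeasurable (fun ω => (R ω, T ω)) P := hR.prodMk hT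
  have hNR : Measurable fun q : ℝ × E => (N q, q.1) := hN.prodMk measurable_fst
  have hmap : P.map (fun ω => (N (R ω, T ω), R ω))
      = ((P.map R).prod (P.map T)).map fun q => (N q, q.1) := by
    rw [← hjoint, AEMeasurable.map_map_of_aemeasurable hNR.aemeasurable hRT]
    rfl
  have heq := condDistrib_ae_eq_of_measure_eq_compProd (μ := P)
    (fun ω => (N (R ω, T ω), R ω)) (hX.comp_aemeasurable hRT)
    (κ := fiberKernel (P.map T) hN hX) (by
      have hmap' : P.map (fun ω => ((N (R ω, T ω), R ω), X (R ω, T ω)))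
          = ((P.map R).prod (P.map T)).map fun q => ((N q, q.1), X q) := by
        rw [← hjoint, AEMeasurable.map_map_of_aemeasurable (hNR.prodMk hX).aemeasurable hRT]
        rfl
      change P.map (fun ω => ((N (R ω, T ω), R ω), X (R ω, T ω))) = _
      rw [hmap', hmap]
      refine Measure.ext_of_lintegral _ fun f hf => ?_
      rw [Measure.lintegral_compProd hf, lintegral_map hf (hNR.prodMk hX),
        lintegral_map (hf.lintegral_kernel_prod_right') hNR,
        lintegral_prod _ (show Measurable fun a => f ((N a, a.1), X a) from
          hf.comp (hNR.prodMk hX)).aemeasurable,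
        lintegral_prod _ (show Measurable fun a : ℝ × E => ∫⁻ b, f ((N a, a.1), b)
          ∂fiberKernel (P.map T) hN hX (N a, a.1) from
          hf.lintegral_kernel_prod_right'.comp hNR).aemeasurable]
      exact lintegral_congr fun s => (lintegral_fiberKernel _ hN hX hf s).symm)
  rw [hmap] at heq
  -- Almost everywhere uniqueness holds along the law of `(N, R)`. By Fubini, for almost every `s`
  -- it holds at `(N (s, p), s)` for almost every `p`; as `N (s, p) = n` has positive mass, some
  -- such `p` realises the value `n`.
  have h1 := Measure.ae_ae_of_ae_prod (ae_of_ae_map hNR.aemeasurable heq)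
  filter_upwards [h1, hn] with s hs hs0
  have hS : MeasurableSet {p | N (s, p) = n} :=
    measurable_prodMk_left (hN (measurableSet_singleton n))
  have hXs : Measurable fun p => X (s, p) := hX.comp measurable_prodMk_left
  have hPS : P.map T {p | N (s, p) = n} ≠ 0 := by
    rw [Measure.map_apply_of_aemeasurable hT hS]
    exact hs0
  obtain ⟨p, hp, hpn⟩ : ∃ p, condDistrib (fun ω => X (R ω, T ω)) (fun ω => (N (R ω, T ω), R ω)) P
      (N (s, p), s) = fiberKernel (P.map T) hN hX (N (s, p), s) ∧ N (s, p) = n := by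
    by_contra hcon
    push Not at hcon
    refine hPS (measure_mono_null ?_ hs)
    intro p hpn hp
    exact hcon p hp hpn
  rw [hpn] at hp
  rw [hp, fiberKernel_apply]
  ext A hA
  have hTc : AEMeasurable T (cond P {ω | N (s, T ω) = n}) :=
    hT.mono_ac (cond_absolutelyContinuous)
  rw [map_cond_apply hS hXs hA, Measure.map_apply_of_aemeasurable
      (show AEMeasurable (fun ω => X (s, T ω)) _ from hXs.comp_aemeasurable hTc) hA,
    Measure.map_apply_of_aemeasurable hT hS, Measure.map_apply_of_aemeasurable hT
      (hS.inter (hXs hA)), ProbabilityTheory.cond, Measure.smul_apply, smul_eq_mul,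
    Measure.restrict_apply₀' (show NullMeasurableSet {ω | N (s, T ω) = n} P from
      hT.nullMeasurableSet_preimage hS), Set.inter_comm]
  rfl

end ConditionalLaw

/-! ### Pathwise formulas for the motion. -/

section Paths

variable {Ω : Type*}

theorem arrivalTime_succ (τ : ℕ → Ω → ℝ) (j : ℕ) (ω : Ω) :
    arrivalTime τ (j + 1) ω = arrivalTime τ j ω + τ j ω := by
  simp [arrivalTime, Finset.sum_range_succ]

theorem monotone_arrivalTime {τ : ℕ → Ω → ℝ} {ω : Ω} (hτ : ∀ j, 0 ≤ τ j ω) :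
    Monotone fun j => arrivalTime τ j ω := by
  refine monotone_nat_of_le_succ fun j => ?_
  rw [arrivalTime_succ]
  linarith [hτ j]

/-- For monotone arrival times the counted set is an initial segment. The bound `1 ≤ n` excludes an
infinite set, to which `Set.ncard` assigns `0`. -/
theorem eventCount_eq_iff {τ : ℕ → Ω → ℝ} {ω : Ω} (hτ : ∀ j, 0 ≤ τ j ω) {s : ℝ} {n : ℕ}
    (hn : 1 ≤ n) : eventCount τ s ω = n ↔
      arrivalTime τ n ω ≤ s ∧ s < arrivalTime τ (n + 1) ω := by
  have hmono := monotone_arrivalTime hτ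
  have hcard : ∀ k : ℕ, (Set.Icc 1 k).ncard = k := by
    intro k
    rw [← Finset.coe_Icc, Set.ncard_coe_finset, Nat.card_Icc]
    omega
  unfold eventCount
  constructor
  · intro h
    have hfin : {j : ℕ | 1 ≤ j ∧ arrivalTime τ j ω ≤ s}.Finite :=
      Set.finite_of_ncard_ne_zero (by omega)
    constructor
    · by_contra hcon
      have hsub : {j : ℕ | 1 ≤ j ∧ arrivalTime τ j ω ≤ s} ⊆ Set.Icc 1 (n - 1) := by
        rintro j ⟨h1, h2⟩
        refine ⟨h1, ?_⟩
        by_contra hj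
        exact hcon ((hmono (show n ≤ j by omega)).trans h2)
      have := Set.ncard_le_ncard hsub (Set.finite_Icc _ _)
      rw [hcard] at this
      omega
    · by_contra hcon
      have hsub : Set.Icc 1 (n + 1) ⊆ {j : ℕ | 1 ≤ j ∧ arrivalTime τ j ω ≤ s} := by
        rintro j ⟨h1, h2⟩
        exact ⟨h1, (hmono h2).trans (not_lt.1 hcon)⟩
      have := Set.ncard_le_ncard hsub hfin
      rw [hcard] at this
      omega
  · rintro ⟨h1, h2⟩
    have : {j : ℕ | 1 ≤ j ∧ arrivalTime τ j ω ≤ s} = Set.Icc 1 n := by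
      ext j
      refine and_congr_right fun _ => ⟨fun h => ?_, fun h => (hmono h).trans h1⟩
      by_contra hj
      exact absurd ((hmono (show n + 1 ≤ j by omega)).trans h) (not_le.2 h2)
    rw [this, hcard]

theorem motionPosition_eq {c : ℝ} {τ θ : ℕ → Ω → ℝ} {s : ℝ} {ω : Ω} {n : ℕ}
    (h : eventCount τ s ω = n) : motionPosition c τ θ s ω =
      c * (∑ j ∈ Finset.range n, τ j ω * Real.cos (θ j ω) +
        (s - arrivalTime τ n ω) * Real.cos (θ n ω)) := by
  unfold motionPosition switchTime
  rw [h, Finset.sum_range_succ]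
  congr 2
  · refine Finset.sum_congr rfl fun j hj => ?_
    have hj' := Finset.mem_range.1 hj
    rw [if_pos (by omega), if_pos (by omega), arrivalTime_succ]
    ring
  · rw [if_neg (by omega), if_pos le_rfl]

/-- Since the periods add up to `s`, averaging `s` with `X/c` replaces each cosine by `(1 + cos θ) /
2`. All terms are then nonnegative and `ENNReal.ofReal` loses nothing. -/
theorem indicator_eventCount_eq_weightedPow {c : ℝ} (hc : 0 < c) {τ θ : ℕ → Ω → ℝ} {s : ℝ}
    {ω : Ω} {n : ℕ} (hn : 1 ≤ n) (hτ : ∀ j, 0 ≤ τ j ω) (k : ℕ) :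
    {ω | eventCount τ s ω = n}.indicator
        (fun ω => ENNReal.ofReal ((s + motionPosition c τ θ s ω / c) / 2) ^ k) ω
      = weightedPow n k s (fun j => τ j ω) (fun j => (1 + Real.cos (θ j ω)) / 2) := by
  have hu : ∀ j, 0 ≤ (1 + Real.cos (θ j ω)) / 2 := fun j => by
    linarith [Real.neg_one_le_cos (θ j ω)]
  have hS : ∑ j : Fin n, τ (j.castSucc : Fin (n + 1)) ω = arrivalTime τ n ω := by
    simp [arrivalTime, Finset.sum_range]
  unfold weightedPow
  simp only [hS, Fin.val_last, ← arrivalTime_succ]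
  by_cases h : arrivalTime τ n ω ≤ s ∧ s < arrivalTime τ (n + 1) ω
  · have hcount := (eventCount_eq_iff hτ hn).2 h
    rw [if_pos h, Set.indicator_of_mem (show ω ∈ {ω | eventCount τ s ω = n} from hcount),
      motionPosition_eq hcount]
    congr 1
    rw [← ENNReal.ofReal_mul (by linarith [h.1])]
    simp_rw [← ENNReal.ofReal_mul (hτ _)]
    rw [← ENNReal.ofReal_sum_of_nonneg fun j _ => mul_nonneg (hτ _) (hu _),
      ← ENNReal.ofReal_add (Finset.sum_nonneg fun j _ => mul_nonneg (hτ _) (hu _))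
        (mul_nonneg (by linarith [h.1]) (hu _))]
    congr 1
    have h1 : ∑ j : Fin n, τ (j.castSucc : Fin (n + 1)) ω *
        ((1 + Real.cos (θ (j.castSucc : Fin (n + 1)) ω)) / 2)
        = (arrivalTime τ n ω + ∑ j ∈ Finset.range n, τ j ω * Real.cos (θ j ω)) / 2 := by
      rw [arrivalTime, ← Finset.sum_add_distrib, Finset.sum_div, Finset.sum_range]
      refine Finset.sum_congr rfl fun j _ => ?_
      simp only [Fin.val_castSucc]
      ring
    rw [h1, mul_div_cancel_left₀ _ hc.ne']
    ring
  · rw [if_neg h, Set.indicator_of_notMem (show ω ∉ {ω | eventCount τ s ω = n} from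
      fun h' => h ((eventCount_eq_iff hτ hn).1 h'))]

theorem abs_motionPosition_le {c : ℝ} (hc : 0 < c) {τ θ : ℕ → Ω → ℝ} {s : ℝ} {ω : Ω} {n : ℕ}
    (hn : 1 ≤ n) (hτ : ∀ j, 0 ≤ τ j ω) (h : eventCount τ s ω = n) :
    |motionPosition c τ θ s ω| ≤ c * s := by
  have h1 := ((eventCount_eq_iff hτ hn).1 h).1
  have hcos : ∀ {x y : ℝ}, 0 ≤ x → |x * Real.cos y| ≤ x := fun {x y} hx => by
    rw [abs_mul, abs_of_nonneg hx]
    exact mul_le_of_le_one_right hx (Real.abs_cos_le_one y)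
  rw [motionPosition_eq h, abs_mul, abs_of_pos hc]
  refine mul_le_mul_of_nonneg_left ?_ hc.le
  have h2 : |∑ j ∈ Finset.range n, τ j ω * Real.cos (θ j ω)| ≤ arrivalTime τ n ω :=
    (Finset.abs_sum_le_sum_abs _ _).trans (Finset.sum_le_sum fun j _ => hcos (hτ j))
  have h3 := hcos (y := θ n ω) (sub_nonneg.2 h1)
  exact (abs_add_le _ _).trans (by linarith)

/-- Position and count factor through the pair of sequences, the variable assumed independent of the
clock. -/
theorem motionPosition_comp (c : ℝ) (τ θ : ℕ → Ω → ℝ) (s : ℝ) (ω : Ω) :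
    motionPosition c τ θ s ω =
      motionPosition c (fun j (p : (ℕ → ℝ) × (ℕ → ℝ)) => p.1 j) (fun j p => p.2 j) s
        ((fun j => τ j ω), (fun j => θ j ω)) := by
  unfold motionPosition switchTime eventCount arrivalTime
  rfl

theorem eventCount_comp (τ θ : ℕ → Ω → ℝ) (s : ℝ) (ω : Ω) :
    eventCount τ s ω = eventCount (fun j (p : (ℕ → ℝ) × (ℕ → ℝ)) => p.1 j) s
        ((fun j => τ j ω), (fun j => θ j ω)) := by
  unfold eventCount arrivalTime
  rfl

end Paths

/-! ### The conditional law at a fixed time. -/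

section FixedTime

variable {Ω : Type*} [MeasurableSpace Ω] {P : Measure Ω}

theorem ae_nonneg_expMeasure (r : ℝ) : ∀ᵐ x ∂expMeasure r, 0 ≤ x := by
  rw [expMeasure, gammaMeasure, ae_withDensity_iff (by unfold gammaPDF; fun_prop)]
  refine Filter.Eventually.of_forall fun x hx => ?_
  by_contra h
  exact hx (gammaPDF_of_neg (not_le.1 h))

variable {m : Fin 2} {c lam : ℝ} {τ θ : ℕ → Ω → ℝ}

theorem ae_forall_nonneg_of_hasLaw_expMeasure (hτ_law : ∀ j, HasLaw (τ j) (expMeasure lam) P) :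
    ∀ᵐ ω ∂P, ∀ j, 0 ≤ τ j ω := by
  rw [ae_all_iff]
  intro j
  have h := ae_nonneg_expMeasure lam
  rw [← (hτ_law j).map_eq] at h
  exact ae_of_ae_map (hτ_law j).aemeasurable h

theorem aemeasurable_pair (hτ : ∀ j, AEMeasurable (τ j) P) (hθ : ∀ j, AEMeasurable (θ j) P) :
    AEMeasurable (fun ω => ((fun j => τ j ω), (fun j => θ j ω))) P :=
  (aemeasurable_pi_iff.2 hτ).prodMk (aemeasurable_pi_iff.2 hθ)

theorem aemeasurable_eventCount (hτ : ∀ j, AEMeasurable (τ j) P) (s : ℝ) :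
    AEMeasurable (eventCount τ s) P := by
  have h : Measurable fun p : ℕ → ℝ => eventCount (fun j (p : ℕ → ℝ) => p j) s p :=
    measurable_eventCount (fun j => measurable_pi_apply j) measurable_const
  exact h.comp_aemeasurable (aemeasurable_pi_iff.2 hτ)

theorem aemeasurable_motionPosition (hτ : ∀ j, AEMeasurable (τ j) P)
    (hθ : ∀ j, AEMeasurable (θ j) P) (s : ℝ) :
    AEMeasurable (motionPosition c τ θ s) P := by
  have h : Measurable fun p : (ℕ → ℝ) × (ℕ → ℝ) =>
      motionPosition c (fun j (p : (ℕ → ℝ) × (ℕ → ℝ)) => p.1 j) (fun j p => p.2 j) s p :=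
    measurable_motionPosition c (fun j => (measurable_pi_apply j).comp measurable_fst)
      (fun j => (measurable_pi_apply j).comp measurable_snd) measurable_const
  rw [funext (motionPosition_comp c τ θ s)]
  exact h.comp_aemeasurable (aemeasurable_pair hτ hθ)

theorem lintegral_eventCount_pow [IsProbabilityMeasure P] (hc : 0 < c) (hlam : 0 < lam)
    (hτ_law : ∀ j, HasLaw (τ j) (expMeasure lam) P) (hτ_indep : iIndepFun τ P)
    (hθ_law : ∀ j, HasLaw (θ j) (angleLaw ((m : ℕ) : ℝ)) P) (hθ_indep : iIndepFun θ P)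
    (hτθ : IndepFun (fun ω j => τ j ω) (fun ω j => θ j ω) P) {n : ℕ} (hn : 1 ≤ n) {s : ℝ}
    (hs : 0 ≤ s) (k : ℕ) :
    ∫⁻ ω in {ω | eventCount τ s ω = n},
        ENNReal.ofReal ((s + motionPosition c τ θ s ω / c) / 2) ^ k ∂P
      = ENNReal.ofReal (lam ^ n / n.factorial * betaMoment (betaIndex m n) k *
          (Real.exp (-(lam * s)) * s ^ (n + k))) := by
  have hτm := fun j => (hτ_law j).aemeasurable
  have hθm := fun j => (hθ_law j).aemeasurable
  have := isProbabilityMeasureBeta (betaIndex_pos m 0) (betaIndex_pos m 0)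
  have := isProbabilityMeasure_expMeasure hlam
  -- The normalisation of the angle density is inherited from its being the law of `θ 0`.
  have : IsProbabilityMeasure (angleLaw ((m : ℕ) : ℝ)) :=
    (hθ_law 0).isProbabilityMeasure_iff.1 inferInstance
  have hpos := ae_forall_nonneg_of_hasLaw_expMeasure hτ_law
  have hu : Measurable fun x : ℝ => (1 + Real.cos x) / 2 := by fun_prop
  have hu_law : ∀ j, HasLaw (fun ω => (1 + Real.cos (θ j ω)) / 2)
      (betaMeasure (betaIndex m 0) (betaIndex m 0)) P := by
    intro j
    rw [betaIndex_zero]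
    have h2 : HasLaw (fun x : ℝ => (1 + Real.cos x) / 2)
        (betaMeasure (((m : ℕ) : ℝ) + 1 / 2) (((m : ℕ) : ℝ) + 1 / 2)) (angleLaw ((m : ℕ) : ℝ)) :=
      ⟨hu.aemeasurable, map_angleLaw (Nat.cast_nonneg _)⟩
    exact h2.fun_comp (hθ_law j)
  have hT : HasLaw (fun ω (j : Fin (n + 1)) => τ j ω) (Measure.pi fun _ => expMeasure lam) P :=
    iIndepFun.hasLaw_pi (fun j : Fin (n + 1) => hτ_law j)
      (hτ_indep.precomp Fin.val_injective)
  have hU : HasLaw (fun ω (j : Fin (n + 1)) => (1 + Real.cos (θ j ω)) / 2)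
      (Measure.pi fun _ => betaMeasure (betaIndex m 0) (betaIndex m 0)) P :=
    iIndepFun.hasLaw_pi (fun j : Fin (n + 1) => hu_law j)
      ((hθ_indep.precomp Fin.val_injective).comp (fun _ x => (1 + Real.cos x) / 2) fun _ => hu)
  have hTU : IndepFun (fun ω (j : Fin (n + 1)) => τ j ω)
      (fun ω (j : Fin (n + 1)) => (1 + Real.cos (θ j ω)) / 2) P :=
    hτθ.comp (φ := fun (x : ℕ → ℝ) (j : Fin (n + 1)) => x j)
      (ψ := fun (x : ℕ → ℝ) (j : Fin (n + 1)) => (1 + Real.cos (x j)) / 2)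
      (by fun_prop) (by fun_prop)
  have hjoint := hTU.hasLaw_prod hT hU
  have hmeas : Measurable fun p : (Fin (n + 1) → ℝ) × (Fin (n + 1) → ℝ) =>
      weightedPow n k s p.1 p.2 :=
    measurable_weightedPow k measurable_const measurable_fst measurable_snd
  have hE : NullMeasurableSet {ω | eventCount τ s ω = n} P :=
    (aemeasurable_eventCount hτm s).nullMeasurableSet_preimage (measurableSet_singleton n)
  rw [← lintegral_indicator₀ hE, lintegral_congr_ae (hpos.mono fun ω hω =>
    indicator_eventCount_eq_weightedPow hc hn hω k)]
  have h := lintegral_weightedPow m hlam n k s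
  rw [if_pos hs] at h
  rw [← h, ← lintegral_prod _ hmeas.aemeasurable]
  exact hjoint.lintegral_comp hmeas.aemeasurable

/-- Given `N(s) = n`, the law of `X(s) / (c s)` is the image of `Beta(v + 1 / 2, v + 1 / 2)`
under `u ↦ 2 u - 1`. -/
theorem map_cond_motionPosition [IsProbabilityMeasure P] (hc : 0 < c) (hlam : 0 < lam)
    (hτ_law : ∀ j, HasLaw (τ j) (expMeasure lam) P) (hτ_indep : iIndepFun τ P)
    (hθ_law : ∀ j, HasLaw (θ j) (angleLaw ((m : ℕ) : ℝ)) P) (hθ_indep : iIndepFun θ P)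
    (hτθ : IndepFun (fun ω j => τ j ω) (fun ω j => θ j ω) P) {n : ℕ} (hn : 1 ≤ n) {s : ℝ}
    (hs : 0 < s) :
    P {ω | eventCount τ s ω = n} ≠ 0 ∧
    (cond P {ω | eventCount τ s ω = n}).map (motionPosition c τ θ s)
      = (betaMeasure (betaIndex m n) (betaIndex m n)).map fun u => c * s * (2 * u - 1) := by
  have hτm := fun j => (hτ_law j).aemeasurable
  have hθm := fun j => (hθ_law j).aemeasurable
  have ha := betaIndex_pos m n
  have := isProbabilityMeasureBeta ha ha
  have hJ := lintegral_eventCount_pow hc hlam hτ_law hτ_indep hθ_law hθ_indep hτθ hn hs.le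
  set E := {ω | eventCount τ s ω = n} with hE_def
  set K : ℝ := lam ^ n / n.factorial * (Real.exp (-(lam * s)) * s ^ n) with hK
  have hKpos : 0 < K := by positivity
  -- The moment of order zero is the Poisson probability of `n` events.
  have hPE : P E = ENNReal.ofReal K := by
    have h := hJ 0
    simp only [pow_zero, lintegral_one, Measure.restrict_apply_univ, betaMoment_zero ha, mul_one,
      add_zero] at h
    exact h
  have hPE0 : P E ≠ 0 := by
    rw [hPE]
    simpa using hKpos
  refine ⟨hPE0, ?_⟩
  have hX := aemeasurable_motionPosition (c := c) hτm hθm s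
  have := cond_isProbabilityMeasure hPE0
  have hX' : AEMeasurable (motionPosition c τ θ s) (cond P E) :=
    hX.mono_ac cond_absolutelyContinuous
  set W : Ω → ℝ := fun ω => (1 + motionPosition c τ θ s ω / (c * s)) / 2 with hW
  have hWm : AEMeasurable W (cond P E) := by
    have hg : Measurable fun x : ℝ => (1 + x / (c * s)) / 2 := by fun_prop
    exact hg.comp_aemeasurable hX'
  have hlaw : (cond P E).map W = betaMeasure (betaIndex m n) (betaIndex m n) := by
    have := Measure.isProbabilityMeasure_map hWm
    refine measure_ext_of_moments ?_ ?_ fun k => ?_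
    · refine (ae_map_iff hWm (p := fun x => x ∈ Set.Icc (0 : ℝ) 1) measurableSet_Icc).2 ?_
      have hE : NullMeasurableSet E P :=
        (aemeasurable_eventCount hτm s).nullMeasurableSet_preimage (measurableSet_singleton n)
      have hpos : ∀ᵐ ω ∂cond P E, ∀ j, 0 ≤ τ j ω :=
        cond_absolutelyContinuous.ae_le (ae_forall_nonneg_of_hasLaw_expMeasure hτ_law)
      filter_upwards [ae_cond_mem₀ hE, hpos] with ω h1 h2
      have h3 := abs_le.1 (abs_motionPosition_le (θ := θ) hc hn h2 h1)
      have h4 : motionPosition c τ θ s ω / (c * s) ≤ 1 := by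
        rw [div_le_one (by positivity)]
        exact h3.2
      have h5 : -1 ≤ motionPosition c τ θ s ω / (c * s) := by
        rw [le_div_iff₀ (by positivity)]
        linarith [h3.1]
      simp only [hW, Set.mem_Icc]
      constructor <;> linarith
    · exact (ae_betaMeasure_mem_Ioo _ _).mono fun x hx => ⟨hx.1.le, hx.2.le⟩
    · rw [lintegral_map' (by fun_prop) hWm, lintegral_pow_betaMeasure ha]
      have h1 : ∀ ω, ENNReal.ofReal ((s + motionPosition c τ θ s ω / c) / 2) ^ k
          = ENNReal.ofReal (s ^ k) * ENNReal.ofReal (W ω) ^ k := by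
        intro ω
        rw [ENNReal.ofReal_pow hs.le, ← mul_pow, ← ENNReal.ofReal_mul hs.le]
        congr 2
        rw [hW]
        field_simp
      have h2 := hJ k
      simp_rw [h1] at h2
      rw [lintegral_const_mul' _ _ ENNReal.ofReal_ne_top,
        show lam ^ n / n.factorial * betaMoment (betaIndex m n) k *
          (Real.exp (-(lam * s)) * s ^ (n + k)) = s ^ k * (K * betaMoment (betaIndex m n) k) by
          rw [hK, pow_add]; ring, ENNReal.ofReal_mul (by positivity),
        ENNReal.mul_right_inj (by simpa using pow_pos hs k) ENNReal.ofReal_ne_top] at h2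
      rw [ProbabilityTheory.cond, lintegral_smul_measure, h2, smul_eq_mul, hPE,
        ENNReal.ofReal_mul hKpos.le, ← mul_assoc,
        ENNReal.inv_mul_cancel (by simpa using hKpos) ENNReal.ofReal_ne_top, one_mul]
  rw [← hlaw, AEMeasurable.map_map_of_aemeasurable (by fun_prop) hWm]
  congr 1
  ext ω
  simp only [Function.comp_apply, hW]
  field_simp
  ring

end FixedTime

/-! ### The law of the Bessel clock and the theorem. -/

section RandomTime

theorem ae_pos_gammaMeasure (a r : ℝ) : ∀ᵐ x ∂gammaMeasure a r, 0 < x := by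
  have h0 : ∀ᵐ x ∂gammaMeasure a r, x ≠ 0 :=
    (withDensity_absolutelyContinuous volume (gammaPDF a r)).ae_le (Measure.ae_ne volume 0)
  have h1 : ∀ᵐ x ∂gammaMeasure a r, 0 ≤ x := by
    rw [gammaMeasure, ae_withDensity_iff (by unfold gammaPDF; fun_prop)]
    refine Filter.Eventually.of_forall fun x hx => ?_
    by_contra h
    exact hx (gammaPDF_of_neg (not_le.1 h))
  filter_upwards [h0, h1] with x hx0 hx1 using lt_of_le_of_ne hx1 (Ne.symm hx0)

/-- The law of the Bessel process at time `t` is that of `√(2 t G)` with `G ~ Gamma(d / 2)`. -/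
theorem hasLaw_besselProcess {Ω : Type*} [MeasurableSpace Ω] {P : Measure Ω}
    [IsProbabilityMeasure P] {d : ℕ} (hd : 1 ≤ d) {B : Fin d → ℝ≥0 → Ω → ℝ}
    (hB : ∀ i, IsBrownianReal (B i) P) (hB_indep : iIndepFun (fun i ω s => B i s ω) P)
    {t : ℝ≥0} (ht : 0 < t) :
    HasLaw (besselProcess B t)
      ((gammaMeasure ((d : ℝ) / 2) 1).map fun g => √(2 * t * g)) P := by
  have h := hasLaw_sq_besselProcess hd hB hB_indep ht
  have ht' : (0 : ℝ) < t := ht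
  have hg : Measurable fun g : ℝ => √(2 * (t : ℝ) * g) := by fun_prop
  have h2 : HasLaw (fun g : ℝ => √(2 * (t : ℝ) * g))
      ((gammaMeasure ((d : ℝ) / 2) 1).map fun g => √(2 * t * g)) (gammaMeasure ((d : ℝ) / 2) 1) :=
    ⟨hg.aemeasurable, rfl⟩
  refine (h2.fun_comp h).congr (Filter.Eventually.of_forall fun ω => ?_)
  have h3 : (2 * (t : ℝ)) * (besselProcess B t ω ^ 2 / (2 * t)) = besselProcess B t ω ^ 2 := by
    field_simp
  simp only [h3]
  exact (Real.sqrt_sq (Real.sqrt_nonneg _)).symm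

end RandomTime

theorem theorem5 {Ω : Type*} [MeasurableSpace Ω] (P : Measure Ω) [IsProbabilityMeasure P]
    (m : Fin 2) (c lam : ℝ) (hc : 0 < c) (hlam : 0 < lam)
    (τ θ : ℕ → Ω → ℝ)
    (hτ_law : ∀ j, HasLaw (τ j) (expMeasure lam) P)
    (hτ_indep : iIndepFun τ P)
    (hθ_law : ∀ j, HasLaw (θ j) (angleLaw ((m : ℕ) : ℝ)) P)
    (hθ_indep : iIndepFun θ P)
    (hτθ : IndepFun (fun ω j => τ j ω) (fun ω j => θ j ω) P)
    (d : ℕ) (hd : 1 ≤ d) (B : Fin d → ℝ≥0 → Ω → ℝ)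
    (hB : ∀ i, IsBrownianReal (B i) P)
    (hB_indep : iIndepFun (fun i ω s => B i s ω) P)
    (t : ℝ≥0) (ht : 0 < t)
    (hR : IndepFun (fun ω => ((fun j => τ j ω), (fun j => θ j ω))) (besselProcess B t) P)
    (n : ℕ) (hn : 1 ≤ n) (hv : (d : ℝ) / 2 - 1 < motionIndex m n) :
    (∀ᵐ s ∂(P.map (besselProcess B t)),
        condLawAtClock P c τ θ (besselProcess B t) n s =
          (cond P {ω | eventCount τ s ω = n}).map (motionPosition c τ θ s)) ∧
      condLawRandomTime P c τ θ (besselProcess B t) n =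
        volume.withDensity (betaGaussianMixtureDensity d (motionIndex m n) c t) := by
  have ht' : (0 : ℝ) < t := ht
  have hτm := fun j => (hτ_law j).aemeasurable
  have hθm := fun j => (hθ_law j).aemeasurable
  have hRlaw := hasLaw_besselProcess hd hB hB_indep ht
  have hsqrt : Measurable fun g : ℝ => √(2 * (t : ℝ) * g) := by fun_prop
  -- The fixed-time law needs `s > 0`, which excludes only a null set of clock values.
  have hpos : ∀ᵐ s ∂P.map (besselProcess B t), 0 < s := by
    rw [hRlaw.map_eq]
    refine (ae_map_iff hsqrt.aemeasurable (p := fun s : ℝ => 0 < s) measurableSet_Ioi).2 ?_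
    filter_upwards [ae_pos_gammaMeasure ((d : ℝ) / 2) 1] with g hg
    positivity
  have hfix : ∀ s : ℝ, 0 < s → P {ω | eventCount τ s ω = n} ≠ 0 ∧
      (cond P {ω | eventCount τ s ω = n}).map (motionPosition c τ θ s)
        = (betaMeasure (betaIndex m n) (betaIndex m n)).map fun u => c * s * (2 * u - 1) :=
    fun s hs => map_cond_motionPosition hc hlam hτ_law hτ_indep hθ_law hθ_indep hτθ hn hs
  have hfst : ∀ j : ℕ, Measurable fun q : ℝ × ((ℕ → ℝ) × (ℕ → ℝ)) => q.2.1 j := fun j => by fun_prop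
  have hsnd : ∀ j : ℕ, Measurable fun q : ℝ × ((ℕ → ℝ) × (ℕ → ℝ)) => q.2.2 j := fun j => by fun_prop
  have hN : Measurable fun q : ℝ × ((ℕ → ℝ) × (ℕ → ℝ)) =>
      eventCount (fun j (p : (ℕ → ℝ) × (ℕ → ℝ)) => p.1 j) q.1 q.2 :=
    measurable_eventCount (τ := fun j (q : ℝ × ((ℕ → ℝ) × (ℕ → ℝ))) => q.2.1 j) hfst measurable_fst
  have hX : Measurable fun q : ℝ × ((ℕ → ℝ) × (ℕ → ℝ)) =>
      motionPosition c (fun j (p : (ℕ → ℝ) × (ℕ → ℝ)) => p.1 j) (fun j p => p.2 j) q.1 q.2 :=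
    measurable_motionPosition c (τ := fun j (q : ℝ × ((ℕ → ℝ) × (ℕ → ℝ))) => q.2.1 j)
      (θ := fun j q => q.2.2 j) hfst hsnd measurable_fst
  have hcond : ∀ᵐ s ∂(P.map (besselProcess B t)),
      condLawAtClock P c τ θ (besselProcess B t) n s =
        (cond P {ω | eventCount τ s ω = n}).map (motionPosition c τ θ s) := by
    have h := condDistrib_ae_eq_map_cond (aemeasurable_pair hτm hθm) hRlaw.aemeasurable hR hN hX
      (n := n) (by
        filter_upwards [hpos] with s hs
        simp_rw [← eventCount_comp τ θ]
        exact (hfix s hs).1)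
    simp_rw [← eventCount_comp τ θ, ← motionPosition_comp c τ θ] at h
    exact h
  refine ⟨hcond, ?_⟩
  have ha := betaIndex_pos m n
  have := isProbabilityMeasureBeta ha ha
  have hmk : Measurable (condLawAtClock P c τ θ (besselProcess B t) n) :=
    (Kernel.measurable _).comp measurable_prodMk_left
  ext A hA
  rw [condLawRandomTime, Measure.bind_apply hA hmk.aemeasurable]
  have hA1 : Measurable (A.indicator (1 : ℝ → ℝ≥0∞)) := measurable_one.indicator hA
  have h1 : ∀ᵐ s ∂P.map (besselProcess B t), condLawAtClock P c τ θ (besselProcess B t) n s A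
      = ∫⁻ u, A.indicator 1 (c * s * (2 * u - 1)) ∂betaMeasure (betaIndex m n) (betaIndex m n) := by
    filter_upwards [hcond, hpos] with s h2 hs
    rw [h2, (hfix s hs).2, ← lintegral_map hA1 (by fun_prop), lintegral_indicator_one hA]
  rw [lintegral_congr_ae h1, hRlaw.map_eq, lintegral_map (Measurable.lintegral_prod_right'
      (f := fun p : ℝ × ℝ => A.indicator 1 (c * p.1 * (2 * p.2 - 1))) (hA1.comp (by fun_prop)))
      hsqrt, ← lintegral_indicator_one hA,
    ← lintegral_gammaMeasure_eq_betaGaussianMixture hd hc ht' hv hA1]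
  -- The index `betaIndex m n` unfolds to `motionIndex m n + 1 / 2`, the parameter in the mixture
  -- identity.
  rfl
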